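/- Let $\gamma_1,\dots,\gamma_M$ be closed plane curves parametrized by arc length (twice differentiable, $\gamma_k$ periodic with period its length $\ell_k>0$), let $\kappa_m>0$, $\zeta>0$ and $\delta,\epsilon,\xi\in\mathbb R$. Assume: (1) every curve $\gamma_k=(x_k,y_k)$ has curvature $\dfrac{|x_k'y_k''-y_k'x_k''|}{(x_k'^2+y_k'^2)^{3/2}}\le\kappa_m$ everywhere; (2) $|\gamma_k(t)-\gamma_l(t')|\ge\delta$ for all $k\ne l$ and all $t,t'$, and $|\gamma_k(t)-\gamma_k(t')|\ge\delta$ whenever the arc-length distance of $t$ and $t'$ along the closed curve, $\min_{n\in\mathbb Z}|t-t'+n\ell_k|$, exceeds $\kappa_m^{-1}\pi/2$. Let $p_{i,*}=\gamma_{k_i}(t_i)$, $i=1,\dots,N$, be pairwise distinct exact samples, with unit tangents $m_{i,*}=\gamma_{k_i}'(t_i)$. Samples $i,j$ on the same curve are called adjacent if one of the arcs between them contains no further sample in its interior; if a curve carries just one sample, that sample is adjacent to itself along the whole curve. Assume that the curves are $\epsilon$-sampled, i.e. the arc between adjacent samples has length less than $\epsilon$, and that (3) adjacent samples satisfy $|p_{i,*}-p_{j,*}|>(1+2^{3/2})(2\xi\epsilon+\zeta)$.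 Let $p_i$ be points and $m_i$ unit vectors (noisy data) such that $|p_i-p_{i,*}|\le\zeta$ and, for one of the two orientations of the true tangent, the angle between $m_i$ and $\pm m_{i,*}$ is less than $\xi$. Suppose $$\delta>4\zeta+4\epsilon\xi+2.1\,\kappa_m\epsilon^2,\qquad \epsilon<\frac1{\kappa_m\sqrt2}.$$ Write $B_r(p)$ for the open ball and $v^\perp$ for $v$ rotated clockwise by $\pi/2$. The noisy polygonalization algorithm, given $(p_i,m_i)_{i}$ and $\kappa_m,\epsilon,\zeta,\xi$, works with the noisy allowed regions $$\tilde A_\epsilon(p_i)=\bigcup_{|p-p_i|<\zeta,\ |m|=1,\ \arccos(m_i\cdot m)<\xi}\Big(B_\epsilon(p)\setminus\bigcup_{\pm}B_{\kappa_m^{-1}}(p\pm\kappa_m^{-1}m^\perp)\Big)$$ and does the following. Step 1: let $E$ be the set of pairs $(i,j)$ with $B_\zeta(p_i)\cap\tilde A_\epsilon(p_j)\ne\emptyset$ and $B_\zeta(p_j)\cap\tilde A_\epsilon(p_i)\neq\emptyset$. Step 2: for each $i$ and each sign let $R_i^\pm=\{j:(i,j)\in E,\ \pm(p_j-p_i)\cdot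 m_i>0\}$ and, if $R_i^\pm\neq\emptyset$, choose $r_i^\pm\in R_i^\pm$ minimizing $|(p_j-p_i)\cdot m_i|$ over $j\in R_i^\pm$. Step 3: output the undirected graph on the vertices $1,\dots,N$ (standing for $p_1,\dots,p_N$) with edges $\{i,r_i^+\}$ and $\{i,r_i^-\}$. Then the algorithm reconstructs the correct polygonalization: whatever the choices in Step 2, its output is the graph in which $i\neq j$ are joined exactly when the samples $p_{i,*},p_{j,*}$ are adjacent. -/

import Mathlib

namespace CurveReconstruction

/-- The Euclidean plane. -/
abbrev Plane := EuclideanSpace ℝ (Fin 2)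

/-- A closed plane curve, parametrized by arc length: `toFun` is traversed once in every
interval of length `length`. -/
structure ClosedCurve where
  toFun : ℝ → Plane
  length : ℝ
  length_pos : 0 < length
  periodic : Function.Periodic toFun length
  differentiable : Differentiable ℝ toFun
  differentiable_deriv : Differentiable ℝ (deriv toFun)
  unit_speed : ∀ t, ‖deriv toFun t‖ = 1

/-- The unsigned curvature `|x' y'' - y' x''| / (x'² + y'²)^(3/2)`. -/
noncomputable def ClosedCurve.curvature (c : ClosedCurve) (t : ℝ) : ℝ :=
  |(deriv c.toFun t) 0 * (deriv (deriv c.toFun) t) 1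
      - (deriv c.toFun t) 1 * (deriv (deriv c.toFun) t) 0|
    / (((deriv c.toFun t) 0) ^ 2 + ((deriv c.toFun t) 1) ^ 2) ^ (3 / 2 : ℝ)

/-- All curves of the figure have curvature at most `κ`. -/
def CurvatureBounded {M : ℕ} (γ : Fin M → ClosedCurve) (κ : ℝ) : Prop :=
  ∀ k t, (γ k).curvature t ≤ κ

/-- Different curves are at distance at least `δ` from each other, and so are any two points of
one curve whose arc-length distance along that (closed) curve exceeds `κ⁻¹ π / 2`. -/
def Separated {M : ℕ} (γ : Fin M → ClosedCurve) (κ δ : ℝ) : Prop :=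
  (∀ k l, k ≠ l → ∀ t t', δ ≤ dist ((γ k).toFun t) ((γ l).toFun t')) ∧
  (∀ k t t', (∀ n : ℤ, κ⁻¹ * Real.pi / 2 < |t - t' + n * (γ k).length|) →
    δ ≤ dist ((γ k).toFun t) ((γ k).toFun t'))

/-- A figure of `M` closed curves with `N` exact samples: sample `i` is the point with parameter
`param i` on the curve number `label i`. -/
structure SampledFigure (M N : ℕ) where
  curve : Fin M → ClosedCurve
  label : Fin N → Fin M
  param : Fin N → ℝ

namespace SampledFigure

variable {M N : ℕ}

/-- The exact sample point. -/
def point (S : SampledFigure M N) (i : Fin N) : Plane :=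
  (S.curve (S.label i)).toFun (S.param i)

/-- The exact unit tangent at a sample. -/
noncomputable def tangent (S : SampledFigure M N) (i : Fin N) : Plane :=
  deriv (S.curve (S.label i)).toFun (S.param i)

/-- Moving forward from sample `i` along its curve, the next sample met is `j`, and it is met
after arc length `s`. -/
def IsNext (S : SampledFigure M N) (i j : Fin N) (s : ℝ) : Prop :=
  0 < s ∧ S.label j = S.label i ∧
  (S.curve (S.label i)).toFun (S.param i + s) = S.point j ∧
  ∀ u ∈ Set.Ioo 0 s, ∀ l, S.label l = S.label i →
    (S.curve (S.label i)).toFun (S.param i + u) ≠ S.point l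

/-- The arc length between adjacent samples is less than `ε`. -/
def EpsSampled (S : SampledFigure M N) (ε : ℝ) : Prop :=
  ∀ i j s, S.IsNext i j s → s < ε

/-- Adjacent samples are at (Euclidean) distance greater than `L`. -/
def AdjacentFartherThan (S : SampledFigure M N) (L : ℝ) : Prop :=
  ∀ i j s, S.IsNext i j s → L < dist (S.point i) (S.point j)

/-- The polygonalization, on the sample indices: the edges are the pairs of adjacent samples. -/
def polygonalization (S : SampledFigure M N) : SimpleGraph (Fin N) :=
  SimpleGraph.fromRel fun i j => ∃ s, S.IsNext i j s

/-- `(p, m)` are noisy data for the exact samples: points are off by at most `ζ`, the unit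
tangents, whose orientation carries no information, by an angle less than `ξ`. -/
def IsNoisyData (S : SampledFigure M N) (ζ ξ : ℝ) (p m : Fin N → Plane) : Prop :=
  ∀ i, dist (p i) (S.point i) ≤ ζ ∧ ‖m i‖ = 1 ∧
    (Real.arccos (inner ℝ (m i) (S.tangent i)) < ξ ∨
      Real.arccos (inner ℝ (m i) (-S.tangent i)) < ξ)

end SampledFigure

/-- Clockwise rotation by `π / 2`. -/
noncomputable def perp (v : Plane) : Plane := !₂[v 1, -v 0]

/-- The two open balls of radius `κ⁻¹` tangent at `p` to the direction `m`. -/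
noncomputable def forbiddenZone (κ : ℝ) (p m : Plane) : Set Plane :=
  Metric.ball (p + κ⁻¹ • perp m) κ⁻¹ ∪ Metric.ball (p - κ⁻¹ • perp m) κ⁻¹

noncomputable def allowedRegion (κ ε : ℝ) (p m : Plane) : Set Plane :=
  Metric.ball p ε \ forbiddenZone κ p m

/-- The union of the allowed regions of all point/unit-tangent pairs near `(p, m)`. -/
noncomputable def noisyAllowedRegion (κ ε ζ ξ : ℝ) (p m : Plane) : Set Plane :=
  {q | ∃ p' m' : Plane, dist p' p < ζ ∧ ‖m'‖ = 1 ∧ Real.arccos (inner ℝ m m') < ξ ∧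
    q ∈ allowedRegion κ ε p' m'}

section Algorithm

variable {N : ℕ}

/-- Step 1: the edges of the graph `G`. -/
def CandidateEdge (κ ε ζ ξ : ℝ) (p m : Fin N → Plane) (i j : Fin N) : Prop :=
  (Metric.ball (p i) ζ ∩ noisyAllowedRegion κ ε ζ ξ (p j) (m j)).Nonempty ∧
  (Metric.ball (p j) ζ ∩ noisyAllowedRegion κ ε ζ ξ (p i) (m i)).Nonempty

/-- Step 2a: the candidates on the side `σ = 1` or `σ = -1` of sample `i`. -/
def sideCandidates (κ ε ζ ξ : ℝ) (p m : Fin N → Plane) (σ : ℝ) (i : Fin N) : Set (Fin N) :=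
  {j | CandidateEdge κ ε ζ ξ p m i j ∧ 0 < σ * inner ℝ (p j - p i) (m i)}

/-- Step 2b: `r` selects for every sample a nearest candidate in the tangential direction on the
side `σ` (`none` exactly if there is no candidate; ties may be broken in any way). -/
def IsNearestSelection (κ ε ζ ξ : ℝ) (p m : Fin N → Plane) (σ : ℝ)
    (r : Fin N → Option (Fin N)) : Prop :=
  ∀ i, (r i = none → sideCandidates κ ε ζ ξ p m σ i = ∅) ∧
    ∀ j, r i = some j → j ∈ sideCandidates κ ε ζ ξ p m σ i ∧
      ∀ k ∈ sideCandidates κ ε ζ ξ p m σ i,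
        |inner ℝ (p j - p i) (m i)| ≤ |inner ℝ (p k - p i) (m i)|

/-- Step 3: `Γ` is a graph that the noisy polygonalization algorithm may return on the data
`(p, m)` with the parameters `κ, ε, ζ, ξ`. -/
def IsNoisyPolygonalizationOutput (κ ε ζ ξ : ℝ) (p m : Fin N → Plane)
    (Γ : SimpleGraph (Fin N)) : Prop :=
  ∃ rPlus rMinus : Fin N → Option (Fin N),
    IsNearestSelection κ ε ζ ξ p m 1 rPlus ∧
    IsNearestSelection κ ε ζ ξ p m (-1) rMinus ∧
    Γ = SimpleGraph.fromRel fun i j => rPlus i = some j ∨ rMinus i = some j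

end Algorithm

end CurveReconstruction

namespace CurveReconstruction

open InnerProductGeometry Filter Topology

/-! Scale lengths by `κ`. A path of curvature at most `κ` turns by at most `κ * u` over arc length
`u`. Hence it advances in a direction at angle at most `ξ` from its initial tangent at rate at least
`cos (κ * u + ξ)`, its chords dominate those of the circle of radius `κ⁻¹`, and short arcs avoid the
open tangent balls (`sin_sub_sin_le_inner`, `two_mul_sin_le_norm_sub`, `two_mul_abs_inner_perp_le`).

Adjacent samples are therefore candidates (`candidateEdge_of_leads`). Conversely, a candidate of `i`
is closer than `δ` to a point of the curve at arc less than `ε` from `i`. Separation then puts it on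
the same curve, at arc at most `π / (2κ) + ε` (`exists_branch_of_candidateEdge`), and the chord
bound improves this to `κ * r ≤ π / 2 - ξ` (`mul_arc_le`).

On that range the projection to the noisy tangent increases with arc length. Noise changes
differences of projections by at most `2ζ`, while the spacing of adjacent samples creates gaps above
`2ζ` (`inner_pos_of_leads`, `inner_lt_of_leads`). So on each side the neighbour on the curve is the
strict minimizer, and every selection in Step 2 is forced (`exists_nearest`). -/

/-! ### Coordinates and rotation in the plane. -/

lemma inner_eq_coords (x y : Plane) : inner ℝ x y = x 0 * y 0 + x 1 * y 1 := by
  simp [PiLp.inner_apply, Fin.sum_univ_two, mul_comm]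

lemma norm_sq_eq_coords (x : Plane) : ‖x‖ ^ 2 = x 0 ^ 2 + x 1 ^ 2 := by
  rw [← real_inner_self_eq_norm_sq, inner_eq_coords]; ring

@[simp] lemma perp_apply_zero (v : Plane) : perp v 0 = v 1 := rfl

@[simp] lemma perp_apply_one (v : Plane) : perp v 1 = -v 0 := rfl

lemma norm_perp (v : Plane) : ‖perp v‖ = ‖v‖ := by
  have : ‖perp v‖ ^ 2 = ‖v‖ ^ 2 := by
    simp only [norm_sq_eq_coords, perp_apply_zero, perp_apply_one]; ring
  exact (pow_left_inj₀ (norm_nonneg _) (norm_nonneg _) two_ne_zero).1 this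

lemma perp_neg (v : Plane) : perp (-v) = -perp v := by
  ext i; fin_cases i <;> simp

lemma perp_smul (a : ℝ) (v : Plane) : perp (a • v) = a • perp v := by
  ext i; fin_cases i <;> simp

lemma perp_add (v w : Plane) : perp (v + w) = perp v + perp w := by
  ext i; fin_cases i <;> simp [add_comm]

lemma inner_perp_self (v : Plane) : inner ℝ v (perp v) = 0 := by
  rw [inner_eq_coords, perp_apply_zero, perp_apply_one]; ring

lemma norm_sq_mul_norm_sq (x y : Plane) :
    ‖x‖ ^ 2 * ‖y‖ ^ 2 = inner ℝ x y ^ 2 + inner ℝ x (perp y) ^ 2 := by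
  simp only [norm_sq_eq_coords, inner_eq_coords, perp_apply_zero, perp_apply_one]; ring

lemma eq_inner_smul_add_inner_perp_smul (x : Plane) {m : Plane} (hm : ‖m‖ = 1) :
    x = inner ℝ x m • m + inner ℝ x (perp m) • perp m := by
  have h : m 0 ^ 2 + m 1 ^ 2 = 1 := by rw [← norm_sq_eq_coords, hm]; norm_num
  ext i
  fin_cases i <;> simp [inner_eq_coords]
  · linear_combination (-x 0) * h
  · linear_combination (-x 1) * h

lemma arccos_inner_eq_angle {E : Type*} [NormedAddCommGroup E] [InnerProductSpace ℝ E]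
    {x y : E} (hx : ‖x‖ = 1) (hy : ‖y‖ = 1) :
    Real.arccos (inner ℝ x y) = angle x y := by
  simp [angle, hx, hy]

/-! ### Angles and chords of the unit sphere. -/

section Angle

variable {E : Type*} [NormedAddCommGroup E] [InnerProductSpace ℝ E]

lemma inner_eq_cos_angle_of_norm_one {x y : E} (hx : ‖x‖ = 1) (hy : ‖y‖ = 1) :
    inner ℝ x y = Real.cos (angle x y) := by
  rw [cos_angle, hx, hy]; simp

lemma norm_sub_eq_two_mul_sin_half_angle {x y : E} (hx : ‖x‖ = 1) (hy : ‖y‖ = 1) :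
    ‖x - y‖ = 2 * Real.sin (angle x y / 2) := by
  have h0 := angle_nonneg x y
  have h1 := angle_le_pi x y
  have hs : 0 ≤ Real.sin (angle x y / 2) :=
    Real.sin_nonneg_of_nonneg_of_le_pi (by linarith) (by linarith)
  have h2 : ‖x - y‖ ^ 2 = (2 * Real.sin (angle x y / 2)) ^ 2 := by
    rw [norm_sub_sq_real, hx, hy, inner_eq_cos_angle_of_norm_one hx hy]
    have := Real.cos_sq (angle x y / 2)
    have h3 := Real.sin_sq_add_cos_sq (angle x y / 2)
    rw [mul_div_cancel₀ _ (two_ne_zero)] at this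
    nlinarith
  exact (pow_left_inj₀ (norm_nonneg _) (by positivity) two_ne_zero).1 h2

lemma norm_sub_le_angle {x y : E} (hx : ‖x‖ = 1) (hy : ‖y‖ = 1) : ‖x - y‖ ≤ angle x y := by
  rw [norm_sub_eq_two_mul_sin_half_angle hx hy]
  have := Real.sin_le (x := angle x y / 2) (by linarith [angle_nonneg x y])
  linarith

/-- With `a` the half angle, `a - a ^ 3 / 6 ≤ sin a` and `a ≤ 2 * sin a`. The error is cubic, so it
disappears under subdivision. -/
lemma angle_le_norm_sub_add_cube {x y : E} (hx : ‖x‖ = 1) (hy : ‖y‖ = 1) :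
    angle x y ≤ ‖x - y‖ + ‖x - y‖ ^ 3 / 3 := by
  have h0 := angle_nonneg x y
  have h1 := angle_le_pi x y
  have h2 := norm_sub_eq_two_mul_sin_half_angle hx hy
  set a := angle x y / 2 with ha
  have h3 := Real.mul_le_sin (x := a) (by linarith) (by linarith)
  have h4 : a ≤ 2 * Real.sin a := by
    have h5 : 1 / 2 * a ≤ 2 / Real.pi * a := by
      refine mul_le_mul_of_nonneg_right ?_ (by linarith)
      rw [div_le_div_iff₀ (by norm_num) Real.pi_pos]; linarith [Real.pi_le_four]
    linarith
  have h6 : a - a ^ 3 / 6 ≤ Real.sin a := by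
    rcases eq_or_lt_of_le (show 0 ≤ a by linarith) with h | h
    · simp [← h]
    · exact (Real.sin_gt_sub_cube h).le
  have h7 : a ^ 3 ≤ (2 * Real.sin a) ^ 3 := by gcongr
  rw [h2]; linarith

/-- The angle between the values of a `κ`-Lipschitz path on the unit sphere is at most `κ` times
the parameter distance. -/
lemma angle_le_mul_abs_sub {κ : ℝ} {v : ℝ → E} (hv : ∀ u, ‖v u‖ = 1)
    (hlip : ∀ a b, ‖v a - v b‖ ≤ κ * |a - b|) (a b : ℝ) : angle (v a) (v b) ≤ κ * |a - b| := by
  have hκ : 0 ≤ κ * |a - b| := (norm_nonneg _).trans (hlip a b)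
  set L := κ * |a - b| with hL
  -- Cut into `n` equal pieces: the cubic errors add up to `n * (L / n) ^ 3 / 3`, which tends to
  -- `0`.
  have key : ∀ n : ℕ, 0 < n → angle (v a) (v b) ≤ L + L ^ 3 / 3 * ((n : ℝ)⁻¹) ^ 2 := by
    intro n hn
    have hn' : (0 : ℝ) < n := by exact_mod_cast hn
    let x : ℕ → ℝ := fun k => a + (b - a) * (k / n)
    have step : ∀ k, angle (v (x k)) (v (x (k + 1))) ≤ L / n + (L / n) ^ 3 / 3 := by
      intro k
      have hx : κ * |x k - x (k + 1)| = L / n := by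
        have : x k - x (k + 1) = (a - b) / n := by simp only [x]; push_cast; field_simp; ring
        rw [this, abs_div, abs_of_pos hn', hL]; ring
      have h1 := hlip (x k) (x (k + 1))
      rw [hx] at h1
      have h2 := angle_le_norm_sub_add_cube (hv (x k)) (hv (x (k + 1)))
      have h3 : ‖v (x k) - v (x (k + 1))‖ ^ 3 ≤ (L / n) ^ 3 := by gcongr
      linarith
    have ind : ∀ k : ℕ, angle (v (x 0)) (v (x k)) ≤ k * (L / n + (L / n) ^ 3 / 3) := by
      intro k
      induction k with
      | zero =>
        have : v (x 0) ≠ 0 := by rw [← norm_pos_iff, hv]; norm_num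
        simp [angle_self this]
      | succ k ih =>
        have := angle_le_angle_add_angle (v (x 0)) (v (x k)) (v (x (k + 1)))
        have := step k
        push_cast; linarith
    have h := ind n
    have e0 : x 0 = a := by simp [x]
    have en : x n = b := by simp only [x]; field_simp; ring
    rw [e0, en] at h
    refine h.trans (le_of_eq ?_)
    field_simp
  have lim : Tendsto (fun n : ℕ => L + L ^ 3 / 3 * ((n : ℝ)⁻¹) ^ 2) atTop (𝓝 L) := by
    have h1 := (tendsto_inv_atTop_nhds_zero_nat (𝕜 := ℝ)).pow 2
    have h2 := (h1.const_mul (L ^ 3 / 3)).const_add L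
    simpa using h2
  exact ge_of_tendsto lim ((eventually_gt_atTop 0).mono key)

end Angle

/-! ### Paths of bounded curvature. -/

/-- `c` is a path of unit speed with velocity `v`, whose direction turns at rate at most `κ`. -/
structure UnitSpeedPath (κ : ℝ) (c v : ℝ → Plane) : Prop where
  hasDerivAt : ∀ u, HasDerivAt c (v u) u
  norm_velocity : ∀ u, ‖v u‖ = 1
  norm_velocity_sub_le : ∀ a b, ‖v a - v b‖ ≤ κ * |a - b|

namespace UnitSpeedPath

variable {κ : ℝ} {c v : ℝ → Plane}

/-- The same path, started at the parameter `t` and run in the direction `σ`. -/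
lemma comp_add_mul (h : UnitSpeedPath κ c v) (t : ℝ) {σ : ℝ} (hσ : |σ| = 1) :
    UnitSpeedPath κ (fun u => c (t + σ * u)) (fun u => σ • v (t + σ * u)) where
  hasDerivAt u := by
    have h1 : HasDerivAt (fun u : ℝ => t + σ * u) σ u := by
      simpa using ((hasDerivAt_id u).const_mul σ).const_add t
    exact (h.hasDerivAt (t + σ * u)).scomp u h1
  norm_velocity u := by rw [norm_smul, h.norm_velocity, Real.norm_eq_abs, hσ, one_mul]
  norm_velocity_sub_le a b := by
    rw [← smul_sub, norm_smul, Real.norm_eq_abs, hσ, one_mul]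
    refine (h.norm_velocity_sub_le _ _).trans (le_of_eq ?_)
    rw [add_sub_add_left_eq_sub, ← mul_sub, abs_mul, hσ, one_mul]

lemma angle_le (h : UnitSpeedPath κ c v) (a b : ℝ) : angle (v a) (v b) ≤ κ * |a - b| :=
  angle_le_mul_abs_sub h.norm_velocity h.norm_velocity_sub_le a b

lemma continuous (h : UnitSpeedPath κ c v) : Continuous c :=
  continuous_iff_continuousAt.2 fun u => (h.hasDerivAt u).continuousAt

lemma norm_sub_le (h : UnitSpeedPath κ c v) (a b : ℝ) : ‖c a - c b‖ ≤ |a - b| := by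
  have := convex_univ.norm_image_sub_le_of_norm_hasDerivWithin_le (f := c) (f' := v) (C := 1)
    (fun u _ => (h.hasDerivAt u).hasDerivWithinAt) (fun u _ => (h.norm_velocity u).le)
    (Set.mem_univ b) (Set.mem_univ a)
  simpa using this

lemma cos_le_inner_velocity (h : UnitSpeedPath κ c v) {w : Plane} (hw : ‖w‖ = 1)
    {ξ : ℝ} (hξ : angle (v 0) w ≤ ξ) {u : ℝ} (hu : 0 ≤ u) (hle : κ * u + ξ ≤ Real.pi) :
    Real.cos (κ * u + ξ) ≤ inner ℝ (v u) w := by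
  rw [inner_eq_cos_angle_of_norm_one (h.norm_velocity u) hw]
  refine Real.cos_le_cos_of_nonneg_of_le_pi (angle_nonneg _ _) hle ?_
  have h1 := angle_le_angle_add_angle (v u) (v 0) w
  have h2 := h.angle_le u 0
  rw [sub_zero, abs_of_nonneg hu] at h2
  linarith

/-- Advance of the path in the direction `w`. -/
lemma sin_sub_sin_le_inner (h : UnitSpeedPath κ c v) (hκ : 0 < κ) {w : Plane} (hw : ‖w‖ = 1)
    {ξ : ℝ} (hξ : angle (v 0) w ≤ ξ) {a b : ℝ} (ha : 0 ≤ a) (hab : a ≤ b)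
    (hb : κ * b + ξ ≤ Real.pi) :
    Real.sin (κ * b + ξ) - Real.sin (κ * a + ξ) ≤ κ * inner ℝ (c b - c a) w := by
  have hder : ∀ u, HasDerivAt (fun u => κ * inner ℝ (c u) w - Real.sin (κ * u + ξ))
      (κ * inner ℝ (v u) w - Real.cos (κ * u + ξ) * κ) u := by
    intro u
    have h1 : HasDerivAt (fun u => inner ℝ (c u) w) (inner ℝ (v u) w) u := by
      simpa using (h.hasDerivAt u).inner ℝ (hasDerivAt_const u w)
    have h2 : HasDerivAt (fun u : ℝ => κ * u + ξ) κ u := by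
      simpa using ((hasDerivAt_id u).const_mul κ).add_const ξ
    exact (h1.const_mul κ).sub h2.sin
  have hmono : MonotoneOn (fun u => κ * inner ℝ (c u) w - Real.sin (κ * u + ξ))
      (Set.Icc a b) := by
    refine monotoneOn_of_deriv_nonneg (convex_Icc a b)
      (fun u _ => (hder u).continuousAt.continuousWithinAt)
      (fun u _ => (hder u).differentiableAt.differentiableWithinAt) ?_
    intro u hu
    rw [interior_Icc] at hu
    rw [(hder u).deriv]
    have hub : κ * u ≤ κ * b := mul_le_mul_of_nonneg_left hu.2.le hκ.le
    have := h.cos_le_inner_velocity hw hξ (u := u) (by linarith [hu.1]) (by linarith)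
    nlinarith
  have := hmono (Set.left_mem_Icc.2 hab) (Set.right_mem_Icc.2 hab) hab
  simp only at this
  rw [inner_sub_left]
  linarith

/-- A chord is at least as long as that of the circular arc of curvature `κ` of the same length. -/
lemma two_mul_sin_le_norm_sub (h : UnitSpeedPath κ c v) (hκ : 0 < κ) {s : ℝ} (hs : 0 ≤ s)
    (hs' : κ * s ≤ 2 * Real.pi) : 2 * Real.sin (κ * s / 2) ≤ κ * ‖c s - c 0‖ := by
  -- Start at the midpoint and run both ways: each half advances by at least `sin (κ * s / 2) / κ`
  -- along the tangent there.
  have hp := h.comp_add_mul (s / 2) (σ := 1) (by simp)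
  have hm := h.comp_add_mul (s / 2) (σ := -1) (by simp)
  have hv0 : v (s / 2) ≠ 0 := by rw [← norm_pos_iff, h.norm_velocity]; norm_num
  have h1 := hp.sin_sub_sin_le_inner hκ (w := v (s / 2)) (h.norm_velocity _) (ξ := 0)
    (by simp [angle_self hv0]) (a := 0) (b := s / 2) le_rfl (by linarith) (by linarith)
  have h2 := hm.sin_sub_sin_le_inner hκ (w := -v (s / 2))
    (by rw [norm_neg]; exact h.norm_velocity _) (ξ := 0)
    (by simp [angle_self hv0]) (a := 0) (b := s / 2) le_rfl (by linarith) (by linarith)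
  have e1 : s / 2 + 1 * (s / 2) = s := by ring
  have e2 : s / 2 + -1 * (s / 2) = 0 := by ring
  have e3 : κ * (s / 2) = κ * s / 2 := by ring
  simp only [e1, e2, e3, mul_zero, add_zero, Real.sin_zero, sub_zero] at h1 h2
  have h3 : inner ℝ (c s - c (s / 2)) (v (s / 2)) + inner ℝ (c 0 - c (s / 2)) (-v (s / 2))
      = inner ℝ (c s - c 0) (v (s / 2)) := by
    rw [inner_neg_right, inner_sub_left, inner_sub_left, inner_sub_left]; ring
  have h4 := real_inner_le_norm (c s - c 0) (v (s / 2))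
  rw [h.norm_velocity, mul_one] at h4
  have h5 := mul_le_mul_of_nonneg_left h4 hκ.le
  rw [← h3, mul_add] at h5
  linarith

lemma norm_sub_sub_smul_le_of_nonneg (h : UnitSpeedPath κ c v) {s : ℝ} (hs : 0 ≤ s) :
    ‖c s - c 0 - s • v 0‖ ≤ κ * s ^ 2 / 2 := by
  have hder : ∀ u, HasDerivAt (fun u => c u - c 0 - u • v 0) (v u - v 0) u := by
    intro u
    have := ((h.hasDerivAt u).sub_const (c 0)).sub ((hasDerivAt_id u).smul_const (v 0))
    rw [one_smul] at this
    exact this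
  have hB : ∀ u : ℝ, HasDerivAt (fun u : ℝ => κ * u ^ 2 / 2) (κ * u) u := by
    intro u
    refine (((hasDerivAt_pow 2 u).const_mul κ).div_const 2).congr_deriv ?_
    push_cast; ring
  refine image_norm_le_of_norm_deriv_right_le_deriv_boundary (a := 0) (b := s)
    (f := fun u => c u - c 0 - u • v 0) (f' := fun u => v u - v 0)
    (fun u _ => (hder u).continuousAt.continuousWithinAt)
    (fun u _ => (hder u).hasDerivWithinAt) (by simp) hB ?_ (Set.right_mem_Icc.2 hs)
  intro u hu
  have := h.norm_velocity_sub_le u 0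
  rwa [sub_zero, abs_of_nonneg hu.1] at this

lemma norm_sub_sub_smul_le (h : UnitSpeedPath κ c v) (s : ℝ) :
    ‖c s - c 0 - s • v 0‖ ≤ κ * s ^ 2 / 2 := by
  rcases le_total 0 s with hs | hs
  · exact h.norm_sub_sub_smul_le_of_nonneg hs
  · have := (h.comp_add_mul 0 (σ := -1) (by simp)).norm_sub_sub_smul_le_of_nonneg
      (s := -s) (by linarith)
    simpa using this

lemma abs_inner_perp_le (h : UnitSpeedPath κ c v) (hκ : 0 < κ) {s : ℝ} (hs : 0 ≤ s)
    (hs' : κ * s ≤ Real.pi / 2) :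
    κ * |inner ℝ (c s - c 0) (perp (v 0))| ≤ 1 - Real.cos (κ * s) := by
  have hder : ∀ u, HasDerivAt (fun u => inner ℝ (c u - c 0) (perp (v 0)))
      (inner ℝ (v u) (perp (v 0))) u := by
    intro u
    simpa using ((h.hasDerivAt u).sub_const (c 0)).inner ℝ (hasDerivAt_const u (perp (v 0)))
  have hB : ∀ u : ℝ, HasDerivAt (fun u : ℝ => κ⁻¹ * (1 - Real.cos (κ * u))) 
      (Real.sin (κ * u)) u := by
    intro u
    have h2 : HasDerivAt (fun u : ℝ => κ * u) κ u := by
      simpa using (hasDerivAt_id u).const_mul κ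
    refine ((h2.cos.const_sub 1).const_mul κ⁻¹).congr_deriv ?_
    field_simp
  have key := image_norm_le_of_norm_deriv_right_le_deriv_boundary (a := 0) (b := s)
    (f := fun u => inner ℝ (c u - c 0) (perp (v 0))) (f' := fun u => inner ℝ (v u) (perp (v 0)))
    (fun u _ => (hder u).continuousAt.continuousWithinAt)
    (fun u _ => (hder u).hasDerivWithinAt) (by simp) hB (by
      intro u hu
      have hus : κ * u ≤ κ * s := mul_le_mul_of_nonneg_left hu.2.le hκ.le
      have hu0 : 0 ≤ κ * u := mul_nonneg hκ.le hu.1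
      have hv0 : v 0 ≠ 0 := by rw [← norm_pos_iff, h.norm_velocity]; norm_num
      have h1 := h.cos_le_inner_velocity (w := v 0) (h.norm_velocity 0) (ξ := 0)
        (by simp [angle_self hv0]) hu.1 (by linarith [Real.pi_pos])
      rw [add_zero] at h1
      -- The tangential part of the unit vector `v u` is at least `cos (κ * u)`, so its normal part
      -- is at most `sin (κ * u)`.
      have h2 := norm_sq_mul_norm_sq (v u) (v 0)
      rw [h.norm_velocity, h.norm_velocity] at h2
      have h3 := Real.cos_nonneg_of_neg_pi_div_two_le_of_le (x := κ * u)
        (by linarith [Real.pi_pos]) (by linarith)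
      have h4 := Real.sin_nonneg_of_nonneg_of_le_pi hu0 (by linarith [Real.pi_pos])
      have h5 := Real.sin_sq_add_cos_sq (κ * u)
      exact abs_le_of_sq_le_sq (by nlinarith) h4) (Set.right_mem_Icc.2 hs)
  simp only [Real.norm_eq_abs] at key
  have := mul_le_mul_of_nonneg_left key hκ.le
  rwa [mul_inv_cancel_left₀ hκ.ne'] at this

/-- Short arcs stay outside the open balls of radius `κ⁻¹` tangent at the starting point. -/
lemma two_mul_abs_inner_perp_le (h : UnitSpeedPath κ c v) (hκ : 0 < κ) {s : ℝ} (hs : 0 ≤ s)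
    (hs' : κ * s ≤ Real.pi / 2) :
    2 * |inner ℝ (c s - c 0) (perp (v 0))| ≤ κ * ‖c s - c 0‖ ^ 2 := by
  have h1 := h.abs_inner_perp_le hκ hs hs'
  have h2 := h.two_mul_sin_le_norm_sub hκ hs (by linarith [Real.pi_pos])
  have h3 := Real.cos_sq (κ * s / 2)
  rw [mul_div_cancel₀ _ (two_ne_zero)] at h3
  have h4 := Real.sin_sq_add_cos_sq (κ * s / 2)
  have h5 : 0 ≤ Real.sin (κ * s / 2) := Real.sin_nonneg_of_nonneg_of_le_pi
    (by positivity) (by linarith [Real.pi_pos])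
  have h6 : (2 * Real.sin (κ * s / 2)) ^ 2 ≤ (κ * ‖c s - c 0‖) ^ 2 := by gcongr
  have h7 : κ * (2 * |inner ℝ (c s - c 0) (perp (v 0))|) ≤ κ * (κ * ‖c s - c 0‖ ^ 2) := by
    nlinarith
  exact le_of_mul_le_mul_left h7 hκ

end UnitSpeedPath

lemma ClosedCurve.unitSpeedPath (γ : ClosedCurve) {κ : ℝ} (hκ : ∀ t, γ.curvature t ≤ κ) :
    UnitSpeedPath κ γ.toFun (deriv γ.toFun) where
  hasDerivAt u := (γ.differentiable u).hasDerivAt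
  norm_velocity := γ.unit_speed
  norm_velocity_sub_le a b := by
    have hbound : ∀ t, ‖deriv (deriv γ.toFun) t‖ ≤ κ := by
      intro t
      have hT := γ.unit_speed t
      -- At unit speed the acceleration is normal to the tangent, so its norm is the curvature.
      have h0 : inner ℝ (deriv (deriv γ.toFun) t) (deriv γ.toFun t) = 0 := by
        have hd := (γ.differentiable_deriv t).hasDerivAt
        have h1 := hd.norm_sq
        have h2 : (fun x => ‖deriv γ.toFun x‖ ^ 2) = fun _ => (1 : ℝ) := by
          funext x; rw [γ.unit_speed]; norm_num
        rw [h2] at h1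
        have h3 := h1.unique (hasDerivAt_const t (1 : ℝ))
        rw [real_inner_comm]; linarith
      have hk := hκ t
      unfold ClosedCurve.curvature at hk
      rw [← norm_sq_eq_coords, hT, one_pow, Real.one_rpow, div_one] at hk
      have h4 := norm_sq_mul_norm_sq (deriv (deriv γ.toFun) t) (deriv γ.toFun t)
      rw [h0, hT] at h4
      have h5 : ‖deriv (deriv γ.toFun) t‖ =
          |inner ℝ (deriv (deriv γ.toFun) t) (perp (deriv γ.toFun t))| := by
        rw [← Real.sqrt_sq_eq_abs, ← Real.sqrt_sq (norm_nonneg (deriv (deriv γ.toFun) t))]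
        congr 1; linarith
      rw [h5, inner_eq_coords, perp_apply_zero, perp_apply_one, ← abs_neg]
      convert hk using 2; ring
    have := convex_univ.norm_image_sub_le_of_norm_hasDerivWithin_le (f := deriv γ.toFun)
      (f' := deriv (deriv γ.toFun)) (C := κ)
      (fun u _ => (γ.differentiable_deriv u).hasDerivAt.hasDerivWithinAt) (fun u _ => hbound u)
      (Set.mem_univ b) (Set.mem_univ a)
    simpa using this

/-! ### Allowed regions, exact and noisy. -/

lemma le_norm_sub_smul_iff {κ : ℝ} (hκ : 0 < κ) {n : Plane} (hn : ‖n‖ = 1) (D : Plane) :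
    κ⁻¹ ≤ ‖D - κ⁻¹ • n‖ ↔ 2 * inner ℝ D n ≤ κ * ‖D‖ ^ 2 := by
  have hκ' : 0 < κ⁻¹ := inv_pos.2 hκ
  rw [← pow_le_pow_iff_left₀ hκ'.le (norm_nonneg _) two_ne_zero, norm_sub_sq_real, norm_smul, hn,
    inner_smul_right, Real.norm_of_nonneg hκ'.le, mul_one]
  constructor
  · intro h
    have h1 : 2 * (κ⁻¹ * inner ℝ D n) ≤ ‖D‖ ^ 2 := by linarith
    have h2 := mul_le_mul_of_nonneg_left h1 hκ.le
    calc _ = κ * (2 * (κ⁻¹ * inner ℝ D n)) := by field_simp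
      _ ≤ _ := h2
  · intro h
    have h2 := mul_le_mul_of_nonneg_left h hκ'.le
    rw [inv_mul_cancel_left₀ hκ.ne'] at h2
    linarith

lemma mem_allowedRegion_iff {κ ε : ℝ} (hκ : 0 < κ) {p q m : Plane} (hm : ‖m‖ = 1) :
    q ∈ allowedRegion κ ε p m ↔
      ‖q - p‖ < ε ∧ 2 * |inner ℝ (q - p) (perp m)| ≤ κ * ‖q - p‖ ^ 2 := by
  have hn : ‖perp m‖ = 1 := by rw [norm_perp, hm]
  have h1 := le_norm_sub_smul_iff hκ hn (q - p)
  have h2 := le_norm_sub_smul_iff hκ (n := -perp m) (by rw [norm_neg, hn]) (q - p)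
  have e1 : q - (p + κ⁻¹ • perp m) = q - p - κ⁻¹ • perp m := by abel
  have e2 : q - (p - κ⁻¹ • perp m) = q - p - κ⁻¹ • -perp m := by rw [smul_neg]; abel
  simp only [allowedRegion, forbiddenZone, Set.mem_sdiff, Set.mem_union, Metric.mem_ball, not_or,
    not_lt, dist_eq_norm, e1, e2, h1, h2]
  rw [inner_neg_right]
  refine and_congr_right fun _ => ⟨fun h => ?_, fun h => ⟨?_, ?_⟩⟩
  · rcases abs_cases (inner ℝ (q - p) (perp m)) with hc | hc <;> linarith [h.1, h.2]
  · linarith [le_abs_self (inner ℝ (q - p) (perp m))]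
  · linarith [neg_le_abs (inner ℝ (q - p) (perp m))]

/-- Tilting the direction `T` slightly towards `D` moves `D` out of the closed tangent balls. -/
lemma exists_tilt {κ ξ : ℝ} (hκ : 0 < κ) {D T m : Plane} (hT : ‖T‖ = 1) (hm : ‖m‖ = 1)
    (hang : angle m T < ξ) (hD : D ≠ 0) (hperp : 2 * |inner ℝ D (perp T)| ≤ κ * ‖D‖ ^ 2) :
    ∃ T' : Plane, ‖T'‖ = 1 ∧ angle m T' < ξ ∧ 2 * |inner ℝ D (perp T')| < κ * ‖D‖ ^ 2 := by
  -- `F` is `D` or `-D`, whichever does not point against `T`. Adding `t • F` leaves the normal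
  -- component of `D` unchanged but lengthens `T`, so normalizing shrinks that component.
  obtain ⟨F, hF0, hFT, hFp⟩ : ∃ F : Plane, F ≠ 0 ∧ 0 ≤ inner ℝ T F ∧ inner ℝ D (perp F) = 0 := by
    rcases le_total 0 (inner ℝ T D) with h | h
    · exact ⟨D, hD, h, inner_perp_self D⟩
    · exact ⟨-D, neg_ne_zero.2 hD, by rw [inner_neg_right]; linarith, by
        rw [perp_neg, inner_neg_right, inner_perp_self, neg_zero]⟩
  have hT0 : T ≠ 0 := by rw [← norm_pos_iff, hT]; norm_num
  have hm0 : m ≠ 0 := by rw [← norm_pos_iff, hm]; norm_num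
  have hcont : ContinuousAt (fun t : ℝ => angle m (T + t • F)) 0 := by
    have h1 : ContinuousAt (fun t : ℝ => (m, T + t • F)) 0 := by fun_prop
    have h2 : ContinuousAt (fun y : Plane × Plane => angle y.1 y.2) (m, T + (0 : ℝ) • F) :=
      continuousAt_angle hm0 (by simpa using hT0)
    exact ContinuousAt.comp (f := fun t : ℝ => (m, T + t • F)) h2 h1
  have hev : ∀ᶠ t in 𝓝[>] (0 : ℝ), angle m (T + t • F) < ξ :=
    (hcont.eventually_lt_const (by simpa using hang)).filter_mono nhdsWithin_le_nhds
  obtain ⟨t, ht, ht0⟩ := (hev.and self_mem_nhdsWithin).exists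
  have ht0 : 0 < t := ht0
  set x := T + t • F with hx
  have hx1 : 1 < ‖x‖ := by
    have h1 : ‖x‖ ^ 2 = 1 + 2 * (t * inner ℝ T F) + t ^ 2 * ‖F‖ ^ 2 := by
      rw [hx, norm_add_sq_real, hT, inner_smul_right, norm_smul, Real.norm_of_nonneg ht0.le]; ring
    have h2 : 0 < t ^ 2 * ‖F‖ ^ 2 := by have := norm_pos_iff.2 hF0; positivity
    have h3 : 0 ≤ t * inner ℝ T F := by positivity
    nlinarith [norm_nonneg x]
  have hx0 : 0 < ‖x‖ := by linarith
  refine ⟨‖x‖⁻¹ • x, ?_, ?_, ?_⟩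
  · rw [norm_smul, norm_inv, norm_norm, inv_mul_cancel₀ hx0.ne']
  · rwa [angle_smul_right_of_pos _ _ (inv_pos.2 hx0)]
  · have h1 : inner ℝ D (perp (‖x‖⁻¹ • x)) = ‖x‖⁻¹ * inner ℝ D (perp T) := by
      rw [perp_smul, inner_smul_right, hx, perp_add, perp_smul, inner_add_right, inner_smul_right,
        hFp, mul_zero, add_zero]
    rw [h1, abs_mul, abs_of_pos (inv_pos.2 hx0)]
    have hinv : ‖x‖⁻¹ < 1 := inv_lt_one_of_one_lt₀ hx1
    have hD' : 0 < κ * ‖D‖ ^ 2 := by have := norm_pos_iff.2 hD; positivity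
    rcases eq_or_lt_of_le (abs_nonneg (inner ℝ D (perp T))) with h | h
    · rw [← h]; simpa using hD'
    · nlinarith

/-- A point in the closed exact allowed region is recognized from noisy data. -/
lemma nonempty_ball_inter_noisyAllowedRegion {κ ε ζ ξ : ℝ} (hκ : 0 < κ) (hζ : 0 < ζ)
    {P Q T p q m : Plane} (hT : ‖T‖ = 1) (hm : ‖m‖ = 1) (hang : angle m T < ξ) (hne : Q ≠ P)
    (hdist : ‖Q - P‖ < ε) (hperp : 2 * |inner ℝ (Q - P) (perp T)| ≤ κ * ‖Q - P‖ ^ 2)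
    (hp : dist p P ≤ ζ) (hq : dist q Q ≤ ζ) :
    (Metric.ball q ζ ∩ noisyAllowedRegion κ ε ζ ξ p m).Nonempty := by
  obtain ⟨T', hT', hang', hperp'⟩ := exists_tilt hκ hT hm hang (sub_ne_zero.2 hne) hperp
  -- Moving both exact points slightly towards the data makes the distances to the data strictly
  -- less than `ζ`, even for noise exactly `ζ`. After the tilt the region conditions are strict at
  -- `t = 0` and persist for small `t`.
  let X : ℝ → Plane := fun t => P + t • (p - P)
  let Y : ℝ → Plane := fun t => Q + t • (q - Q)
  have hX : Continuous X := by fun_prop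
  have hY : Continuous Y := by fun_prop
  have hp' : Continuous fun t => 2 * |inner ℝ (Y t - X t) (perp T')| := by fun_prop
  have hev1 : ∀ᶠ t in 𝓝[>] (0 : ℝ), ‖Y t - X t‖ < ε :=
    (((hY.sub hX).norm.continuousAt (x := 0)).eventually_lt_const
      (by simpa [X, Y] using hdist)).filter_mono nhdsWithin_le_nhds
  have hev2 : ∀ᶠ t in 𝓝[>] (0 : ℝ),
      2 * |inner ℝ (Y t - X t) (perp T')| < κ * ‖Y t - X t‖ ^ 2 :=
    ((hp'.continuousAt (x := 0)).eventually_lt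
      ((((hY.sub hX).norm.pow 2).const_mul κ).continuousAt)
      (by simpa [X, Y] using hperp')).filter_mono nhdsWithin_le_nhds
  have hev3 : ∀ᶠ t in 𝓝[>] (0 : ℝ), t < 1 :=
    (eventually_lt_nhds (zero_lt_one)).filter_mono nhdsWithin_le_nhds
  obtain ⟨t, ⟨⟨h1, h2⟩, h3⟩, h4⟩ :=
    (((hev1.and hev2).and hev3).and self_mem_nhdsWithin).exists
  have h4 : 0 < t := h4
  have close : ∀ x y : Plane, dist x y ≤ ζ → dist (y + t • (x - y)) x < ζ := by
    intro x y h
    have e : y + t • (x - y) - x = (1 - t) • (y - x) := by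
      module
    rw [dist_eq_norm, e, norm_smul, Real.norm_of_nonneg (by linarith), ← dist_eq_norm, dist_comm]
    nlinarith [dist_nonneg (x := x) (y := y)]
  refine ⟨Y t, close q Q hq, X t, T', close p P hp, hT', ?_,
    (mem_allowedRegion_iff hκ hT').2 ⟨h1, h2.le⟩⟩
  rwa [arccos_inner_eq_angle hm hT']

/-- A point recognized from noisy data is close to the curve. -/
lemma UnitSpeedPath.exists_dist_lt {κ ε ζ ξ : ℝ} {c v : ℝ → Plane} (h : UnitSpeedPath κ c v)
    (hκ : 0 < κ) {Q p q m : Plane} (hm : ‖m‖ = 1) (hang : angle m (v 0) < ξ)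
    (hp : dist p (c 0) ≤ ζ) (hq : dist q Q ≤ ζ)
    (hne : (Metric.ball q ζ ∩ noisyAllowedRegion κ ε ζ ξ p m).Nonempty) :
    ‖Q - c 0‖ < ε + 4 * ζ ∧
      ∃ a, |a| < ε ∧ dist (c a) Q < 4 * ζ + 2 * ε * ξ + κ * ε ^ 2 := by
  obtain ⟨q', hq', p', m', hp', hm', hang', hq'p'⟩ := hne
  rw [arccos_inner_eq_angle hm hm'] at hang'
  obtain ⟨hlt, hperp⟩ := (mem_allowedRegion_iff hκ hm').1 hq'p'
  rw [Metric.mem_ball] at hq'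
  have hv := h.norm_velocity 0
  have hε : 0 < ε := (norm_nonneg _).trans_lt hlt
  have n1 : ‖Q - q'‖ < 2 * ζ := by
    rw [← dist_eq_norm]
    linarith [dist_triangle Q q q', dist_comm Q q, dist_comm q q']
  have n2 : ‖p' - c 0‖ < 2 * ζ := by
    rw [← dist_eq_norm]
    linarith [dist_triangle p' p (c 0)]
  refine ⟨?_, inner ℝ (q' - p') m', ?_, ?_⟩
  · calc ‖Q - c 0‖ = ‖(Q - q') + (q' - p') + (p' - c 0)‖ := by congr 1; abel
      _ ≤ ‖Q - q'‖ + ‖q' - p'‖ + ‖p' - c 0‖ := norm_add₃_le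
      _ < _ := by linarith
  · have := abs_real_inner_le_norm (q' - p') m'
    rw [hm', mul_one] at this
    linarith
  · set a := inner ℝ (q' - p') m' with ha
    have ha' : |a| < ε := by
      have := abs_real_inner_le_norm (q' - p') m'
      rw [hm', mul_one] at this
      linarith
    have n3 : ‖(q' - p') - a • m'‖ ≤ κ * ε ^ 2 / 2 := by
      have e := eq_inner_smul_add_inner_perp_smul (q' - p') hm'
      have e' : (q' - p') - a • m' = inner ℝ (q' - p') (perp m') • perp m' :=
        sub_eq_of_eq_add' e
      rw [e', norm_smul, norm_perp, hm', mul_one, Real.norm_eq_abs]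
      have : κ * ‖q' - p'‖ ^ 2 ≤ κ * ε ^ 2 := by gcongr
      linarith
    have n4 : ‖a • (m' - v 0)‖ ≤ ε * (2 * ξ) := by
      rw [norm_smul, Real.norm_eq_abs]
      have h1 := norm_sub_le_angle hm' hv
      have h2 := angle_le_angle_add_angle m' m (v 0)
      rw [angle_comm m' m] at h2
      exact mul_le_mul ha'.le (by linarith) (norm_nonneg _) hε.le
    have n5 := h.norm_sub_sub_smul_le a
    have n6 : κ * a ^ 2 ≤ κ * ε ^ 2 := by
      have := sq_le_sq' (by linarith [(abs_lt.1 ha').1]) (abs_lt.1 ha').2.le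
      gcongr
    rw [dist_comm, dist_eq_norm]
    -- The error budget: `2ζ` for each point, `κε²/2` for the normal offset in the allowed region,
    -- `2εξ` for the direction, `κε²/2` for the curve leaving its tangent.
    calc ‖Q - c a‖ = ‖(Q - q') + (p' - c 0) + ((q' - p') - a • m') + a • (m' - v 0)
          - (c a - c 0 - a • v 0)‖ := by congr 1; rw [smul_sub]; abel
      _ ≤ ‖Q - q'‖ + ‖p' - c 0‖ + ‖(q' - p') - a • m'‖ + ‖a • (m' - v 0)‖
          + ‖c a - c 0 - a • v 0‖ := by
        refine (_root_.norm_sub_le _ _).trans ?_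
        gcongr
        refine (norm_add_le _ _).trans ?_
        gcongr
        exact norm_add₃_le
      _ < _ := by linarith

/-! ### Numerical estimates. -/

/-- `0.99` lies just below `π / 3 - 0.057`, where the subtraction formula applies. -/
lemma cos_ge_of_le {x : ℝ} (h0 : 0 ≤ x) (hx : x ≤ 0.99) : 0.548 ≤ Real.cos x := by
  have hpi := Real.pi_gt_d6
  have h1 : Real.cos (Real.pi / 3 - 0.057) ≤ Real.cos x :=
    Real.cos_le_cos_of_nonneg_of_le_pi h0 (by linarith) (by linarith)
  rw [Real.cos_sub, Real.cos_pi_div_three, Real.sin_pi_div_three] at h1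
  have h2 := Real.one_sub_sq_div_two_le_cos (x := 0.057)
  have h3 := Real.sin_gt_sub_cube (x := 0.057) (by norm_num)
  have h4 : (1.73 : ℝ) ≤ Real.sqrt 3 := Real.le_sqrt_of_sq_le (by norm_num)
  nlinarith

lemma sin_half_ge {s : ℝ} (h0 : 0 < s) (hs : s < 0.7072) : 0.979 * s ≤ 2 * Real.sin (s / 2) := by
  have h := Real.sin_gt_sub_cube (x := s / 2) (by linarith)
  have h1 : s ^ 2 ≤ 0.50014 := by nlinarith
  nlinarith

lemma cos_sub_le_cos_add {x y : ℝ} (hy : 0 ≤ y) : Real.cos x - y ≤ Real.cos (x + y) := by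
  have h := Real.abs_cos_sub_cos_le (x + y) x
  rw [add_sub_cancel_left, abs_of_nonneg hy] at h
  linarith [(abs_le.1 h).1]

section Bounds

variable {e z x s : ℝ}

/-- Here and below lengths are multiplied by `κ`: `e`, `z`, `d` stand for `κε`, `κζ`, `κδ`, while
`x` is `ξ` and `s`, `h`, `r` are scaled arcs. The factor `3.828` is `1 + 2^(3/2)` rounded down, and
`0.7072` is `1 / √2` rounded up. -/
lemma noise_bounds (hx : 0 < x) (he : e < 0.7072) (hs : s < e)
    (hA : 3.828 * (2 * x * e + z) < s) (hz : 0 < z) (he0 : 0 < e) : x < 0.131 ∧ 3.828 * z < e := by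
  constructor
  · nlinarith
  · nlinarith [mul_pos hx he0]

/-- The first sample met is clearly ahead. -/
lemma two_mul_lt_sin_sub_sin (hx : 0 < x) (he : e < 0.7072) (hs : s < e)
    (hA : 3.828 * (2 * x * e + z) < s) (hz : 0 < z) (he0 : 0 < e) :
    2 * z < Real.sin (s + x) - Real.sin x := by
  obtain ⟨hx', hz'⟩ := noise_bounds hx he hs hA hz he0
  have hs0 : 0 < s := by nlinarith [mul_pos hx he0]
  rw [Real.sin_sub_sin]
  have e1 : (s + x - x) / 2 = s / 2 := by ring
  have e2 : (s + x + x) / 2 = s / 2 + x := by ring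
  rw [e1, e2]
  have h1 := sin_half_ge hs0 (by linarith)
  have h2 := cos_ge_of_le (x := s / 2 + x) (by linarith) (by linarith)
  -- The margin is `0.979 * 0.548 * 3.828 > 2`.
  nlinarith [mul_pos hx he0]

variable {r C d : ℝ}

/-- A recognized point of the same curve is met before the curve has turned by a right angle. -/
lemma arc_le_pi_div_two_sub (hx : 0 < x) (he : e < 0.7072) (hs : s < e)
    (hA : 3.828 * (2 * x * e + z) < s) (hz : 0 < z) (he0 : 0 < e)
    (hr : r ≤ Real.pi / 2 + e) (hC : C < e + 4 * z) (hchord : 2 * Real.sin (r / 2) ≤ C)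
    (hd : 4 * z + 4 * e * x + 2.1 * e ^ 2 < d) (hfar : Real.pi / 2 < r → d ≤ C)
    (hnear : r ≤ Real.pi / 2 → d ≤ C + (Real.pi / 2 - r)) : r ≤ Real.pi / 2 - x := by
  obtain ⟨hx', hz'⟩ := noise_bounds hx he hs hA hz he0
  have hpi := Real.pi_gt_d2
  have hpi' := Real.pi_lt_d2
  by_contra! hlt
  have h4 : (1.4 : ℝ) ≤ Real.sqrt 2 := Real.le_sqrt_of_sq_le (by norm_num)
  rcases le_or_gt r (Real.pi / 2) with h | h
  · have h1 := hnear h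
    have h2 : Real.sin 0.7 ≤ Real.sin (r / 2) :=
      Real.sin_le_sin_of_le_of_le_pi_div_two (by linarith) (by linarith) (by linarith)
    have h3 := Real.sin_gt_sub_cube (x := 0.7) (by norm_num)
    -- The chord is below `e + 4 * z < (1 + 4 / 3.828) * e`, which forces `e` to be large. Then `2.1
    -- * e ^ 2 + 4 * e * x` exceeds `e + x`, against separation.
    have h5 : 0.6 < e := by
      norm_num at h3
      nlinarith
    nlinarith [mul_pos hx he0]
  · have h1 := hfar h
    have h2 : Real.sin (Real.pi / 4) ≤ Real.sin (r / 2) := by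
      rcases le_total (r / 2) (Real.pi / 2) with h' | h'
      · exact Real.sin_le_sin_of_le_of_le_pi_div_two (by linarith) h' (by linarith)
      · rw [← Real.sin_pi_sub (r / 2)]
        exact Real.sin_le_sin_of_le_of_le_pi_div_two (by linarith) (by linarith) (by linarith)
    rw [Real.sin_pi_div_four] at h2
    have h5 : 0.6 < e := by nlinarith
    nlinarith [mul_pos hx he0]

variable {h : ℝ}

/-- The second sample met is clearly farther ahead than the first one. -/
lemma two_mul_lt_sin_sub_sin_of_next (hx : 0 < x) (he : e < 0.7072) (hs : s < e) (hh : h < e)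
    (hA : 3.828 * (2 * x * e + z) < s) (hB : 3.828 * (2 * x * e + z) < h) (hz : 0 < z)
    (he0 : 0 < e) (hr : s + h ≤ r) (hC : C < e + 4 * z)
    (hd : 4 * z + 4 * e * x + 2.1 * e ^ 2 < d) (hnear : d ≤ C + (Real.pi / 2 - r)) :
    2 * z < Real.sin (s + h + x) - Real.sin (s + x) := by
  obtain ⟨hx', hz'⟩ := noise_bounds hx he hs hA hz he0
  have hpi := Real.pi_lt_d6
  have hxe := mul_pos hx he0
  have hs0 : 0 < s := by nlinarith
  have hh0 : 0 < h := by nlinarith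
  -- Otherwise `s + h > 1.98 - e`, and separation gives `2.1 * e ^ 2 < 2 * e + π / 2 - 1.98`, which
  -- barely fails for `e > 0.66`. The coefficient `2.1` leaves little room here.
  have hy : s + h / 2 < 0.99 := by
    by_contra! hy
    have h1 : 0.66 < e := by linarith
    have h2 : 2.1 * e ^ 2 < 2 * e + 1.5708 - 1.98 := by nlinarith
    nlinarith
  rw [Real.sin_sub_sin]
  have e1 : (s + h + x - (s + x)) / 2 = h / 2 := by ring
  have e2 : (s + h + x + (s + x)) / 2 = s + h / 2 + x := by ring
  rw [e1, e2]
  have h1 := sin_half_ge hh0 (by linarith)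
  have h2 := cos_ge_of_le (x := s + h / 2) (by linarith) hy.le
  have h3 := cos_sub_le_cos_add (x := s + h / 2) hx.le
  have h4 : 0.548 - x ≤ Real.cos (s + h / 2 + x) := by linarith
  have h5 : (0.548 - x) * (0.979 * h) ≤ Real.cos (s + h / 2 + x) * (2 * Real.sin (h / 2)) :=
    mul_le_mul h4 h1 (by positivity) (by linarith)
  -- The loss from the angle `x` is absorbed by the term `2 * x * e` in `hB`.
  have h6 : x * h ≤ x * e := by gcongr
  nlinarith

end Bounds

/-! ### Samples met along a curve. -/

namespace SampledFigure

variable {M N : ℕ} (S : SampledFigure M N)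

/-- The curve through the sample `i`, run from there in the direction `σ = 1` or `σ = -1`. -/
def branch (σ : ℝ) (i : Fin N) (u : ℝ) : Plane :=
  (S.curve (S.label i)).toFun (S.param i + σ * u)

/-- Moving from sample `i` in the direction `σ`, the first sample met is `j`, after arc length
`s`. -/
def Leads (σ : ℝ) (i j : Fin N) (s : ℝ) : Prop :=
  0 < s ∧ S.label j = S.label i ∧ S.branch σ i s = S.point j ∧
    ∀ u ∈ Set.Ioo 0 s, ∀ l, S.label l = S.label i → S.branch σ i u ≠ S.point l

variable {S}

@[simp] lemma branch_zero (σ : ℝ) (i : Fin N) : S.branch σ i 0 = S.point i := by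
  simp [branch, point]

lemma leads_one_iff {i j : Fin N} {s : ℝ} : S.Leads 1 i j s ↔ S.IsNext i j s := by
  simp [Leads, IsNext, branch]

lemma Leads.le {σ : ℝ} {i j l : Fin N} {s r : ℝ} (h : S.Leads σ i j s) (hr : 0 < r)
    (hl : S.label l = S.label i) (hb : S.branch σ i r = S.point l) : s ≤ r := by
  by_contra! hlt
  exact h.2.2.2 r ⟨hr, hlt⟩ l hl hb

lemma Leads.unique {σ : ℝ} {i j l : Fin N} {s r : ℝ} (hinj : Function.Injective S.point)
    (h : S.Leads σ i j s) (h' : S.Leads σ i l r) : j = l := by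
  have hsr : s = r := le_antisymm (h.le h'.1 h'.2.1 h'.2.2.1) (h'.le h.1 h.2.1 h.2.2.1)
  exact hinj (by rw [← h.2.2.1, ← h'.2.2.1, hsr])

lemma unitSpeedPath_branch {κ : ℝ} (hcurv : CurvatureBounded S.curve κ) {σ : ℝ} (hσ : |σ| = 1)
    (i : Fin N) : UnitSpeedPath κ (S.branch σ i)
      (fun u => σ • deriv (S.curve (S.label i)).toFun (S.param i + σ * u)) :=
  ((S.curve (S.label i)).unitSpeedPath (hcurv _)).comp_add_mul (S.param i) hσ

lemma exists_leads {κ : ℝ} (hcurv : CurvatureBounded S.curve κ) {σ : ℝ} (hσ : |σ| = 1)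
    (i : Fin N) : ∃ j s, S.Leads σ i j s := by
  have hpath := unitSpeedPath_branch hcurv hσ i
  -- Nonzero velocity keeps the start free of samples, so a first one can be sought on a compact
  -- interval.
  have hnear : ∀ᶠ u in 𝓝[>] (0 : ℝ), ∀ l, S.branch σ i u ≠ S.point l := by
    rw [eventually_all]
    intro l
    refine ((hpath.hasDerivAt 0).eventually_ne ?_).filter_mono
      (nhdsWithin_mono _ fun u (hu : 0 < u) => hu.ne')
    rw [← norm_pos_iff, hpath.norm_velocity 0]; exact one_pos
  obtain ⟨η, hη, hfree⟩ := mem_nhdsGT_iff_exists_Ioo_subset.1 hnear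
  have hη : 0 < η := hη
  set ℓ := (S.curve (S.label i)).length with hℓ
  have hℓ0 : 0 < ℓ := (S.curve (S.label i)).length_pos
  have hback : S.branch σ i ℓ = S.point i := by
    have hper := (S.curve (S.label i)).periodic
    rcases eq_or_eq_neg_of_abs_eq hσ with h | h
    · simp only [branch, point, h, one_mul]; exact hper _
    · simp only [branch, point, h, neg_one_mul, ← sub_eq_add_neg]; exact hper.sub_eq _
  let F : Set Plane := S.point '' {l | S.label l = S.label i}
  have hF : IsClosed F := (Set.toFinite F).isClosed
  -- The lower end excludes the start but keeps the period `ℓ`, where sample `i` itself returns; so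
  -- `K` is nonempty.
  let K : Set ℝ := Set.Icc (min η ℓ) ℓ ∩ S.branch σ i ⁻¹' F
  have hK : IsCompact K := isCompact_Icc.inter_right (hF.preimage hpath.continuous)
  have hne : K.Nonempty := ⟨ℓ, ⟨min_le_right _ _, le_rfl⟩, i, rfl, hback.symm⟩
  obtain ⟨s, ⟨hsI, j, hj, hjs⟩, hmin⟩ := hK.exists_isLeast hne
  refine ⟨j, s, (lt_min hη hℓ0).trans_le hsI.1, hj, hjs.symm, ?_⟩
  intro u hu l hl hul
  rcases lt_or_ge u (min η ℓ) with h | h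
  · exact hfree ⟨hu.1, h.trans_le (min_le_left _ _)⟩ l hul
  · exact absurd (hmin ⟨⟨h, hu.2.le.trans hsI.2⟩, l, hl, hul.symm⟩) (not_le.2 hu.2)

end SampledFigure

/-! ### Closed curves and separation. -/

lemma exists_sign_mul_abs_eq (r : ℝ) : ∃ σ : ℝ, |σ| = 1 ∧ σ * |r| = r := by
  rcases le_total 0 r with h | h
  · exact ⟨1, abs_one, by rw [abs_of_nonneg h, one_mul]⟩
  · exact ⟨-1, by simp, by rw [abs_of_nonpos h]; ring⟩

/-- A shorter period would have a chord of positive length by the chord bound, but the curve closes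
up. -/
lemma ClosedCurve.two_pi_le_mul_length (γ : ClosedCurve) {κ : ℝ} (hκ : 0 < κ)
    (hcurv : ∀ t, γ.curvature t ≤ κ) : 2 * Real.pi ≤ κ * γ.length := by
  by_contra! hlt
  have h := (γ.unitSpeedPath hcurv).two_mul_sin_le_norm_sub hκ γ.length_pos.le hlt.le
  have h0 : γ.toFun γ.length = γ.toFun 0 := by simpa using γ.periodic 0
  have hpos : 0 < κ * γ.length := mul_pos hκ γ.length_pos
  have := Real.sin_pos_of_pos_of_lt_pi (x := κ * γ.length / 2) (by linarith) (by linarith)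
  rw [h0, sub_self, norm_zero, mul_zero] at h
  linarith

section Separated

variable {M : ℕ} {γ : Fin M → ClosedCurve} {κ δ : ℝ}

lemma Separated.exists_abs_le (hsep : Separated γ κ δ) {k : Fin M} {t t' : ℝ}
    (hd : dist ((γ k).toFun t) ((γ k).toFun t') < δ) :
    ∃ n : ℤ, |t - t' + n * (γ k).length| ≤ κ⁻¹ * Real.pi / 2 := by
  by_contra! hn
  exact (hsep.2 k t t' hn).not_gt hd

/-- Separation makes the curve simple: coinciding points have arc distance at most `π / (2κ)`, and
there the chord bound excludes a nonzero arc. -/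
lemma Separated.eq_add_int_mul_length (hsep : Separated γ κ δ) (hκ : 0 < κ) (hδ : 0 < δ)
    (hcurv : CurvatureBounded γ κ) {k : Fin M} {t t' : ℝ}
    (heq : (γ k).toFun t = (γ k).toFun t') : ∃ n : ℤ, t' = t + n * (γ k).length := by
  obtain ⟨n, hn⟩ := hsep.exists_abs_le (k := k) (t := t) (t' := t')
    (by rw [heq, dist_self]; exact hδ)
  refine ⟨n, ?_⟩
  set r := t - t' + n * (γ k).length with hr
  by_contra hne
  have hr0 : r ≠ 0 := fun h => hne (by linarith)
  have hpath := (γ k).unitSpeedPath (hcurv k)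
  have hback : (γ k).toFun (t' + r) = (γ k).toFun t' := by
    have e : t' + r = t + n * (γ k).length := by rw [hr]; ring
    rw [e, ← heq]; exact (γ k).periodic.int_mul n t
  have hκr : κ * |r| ≤ Real.pi / 2 := by
    have := mul_le_mul_of_nonneg_left hn hκ.le
    rwa [← mul_div_assoc, mul_inv_cancel_left₀ hκ.ne'] at this
  have hpos : 0 < κ * |r| := mul_pos hκ (abs_pos.2 hr0)
  have hsin := Real.sin_pos_of_pos_of_lt_pi (x := κ * |r| / 2) (by linarith)
    (by linarith [Real.pi_pos])
  obtain ⟨σ, hσ, hσr⟩ := exists_sign_mul_abs_eq r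
  have h := (hpath.comp_add_mul t' hσ).two_mul_sin_le_norm_sub hκ (abs_nonneg r)
    (by linarith [Real.pi_pos])
  simp only [hσr, mul_zero, add_zero, hback, sub_self, norm_zero] at h
  linarith

/-- Points of one curve whose arc distance is between `π / (2 κ)` and `3 π / (2 κ)` are far
apart. -/
lemma Separated.le_dist_of_arc (hsep : Separated γ κ δ) (hκ : 0 < κ)
    (hcurv : CurvatureBounded γ κ) {k : Fin M} {t σ r : ℝ} (hσ : |σ| = 1)
    (hr : Real.pi / 2 < κ * r) (hr' : κ * r < 3 * Real.pi / 2) :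
    δ ≤ dist ((γ k).toFun t) ((γ k).toFun (t + σ * r)) := by
  refine hsep.2 k t (t + σ * r) fun n => ?_
  have hℓ := (γ k).two_pi_le_mul_length hκ (hcurv k)
  have hpi := Real.pi_pos
  have hr0 : 0 < r := by
    by_contra! h
    nlinarith
  have key : Real.pi / 2 < κ * |t - (t + σ * r) + n * (γ k).length| := by
    have e : t - (t + σ * r) + n * (γ k).length = n * (γ k).length - σ * r := by ring
    rw [e]
    rcases eq_or_ne n 0 with h | h
    · simp only [h, Int.cast_zero, zero_mul, zero_sub, abs_neg, abs_mul, hσ, one_mul,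
        abs_of_pos hr0]
      exact hr
    -- Any other way round has length at least `ℓ - r`, and `κ * ℓ ≥ 2π`.
    · have h1 : (1 : ℝ) ≤ |(n : ℝ)| := by exact_mod_cast Int.one_le_abs h
      have h2 := abs_sub_abs_le_abs_sub (n * (γ k).length) (σ * r)
      rw [abs_mul, abs_mul, hσ, one_mul, abs_of_pos hr0, abs_of_pos (γ k).length_pos] at h2
      have h3 : (γ k).length ≤ |(n : ℝ)| * (γ k).length :=
        le_mul_of_one_le_left (γ k).length_pos.le h1
      have h4 := mul_le_mul_of_nonneg_left (h3.trans (sub_le_iff_le_add.1 h2)) hκ.le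
      rw [mul_add] at h4
      linarith
  rw [mul_div_assoc, inv_mul_lt_iff₀ hκ]
  exact key

end Separated

/-! ### Standing assumptions and candidate edges. -/

lemma SampledFigure.norm_tangent {M N : ℕ} (S : SampledFigure M N) (i : Fin N) :
    ‖S.tangent i‖ = 1 :=
  (S.curve _).unit_speed _

/-- The standing assumptions on the figure, the data and the parameters. -/
structure Admissible {M N : ℕ} (S : SampledFigure M N) (p m : Fin N → Plane)
    (κ δ ε ζ ξ : ℝ) : Prop where
  curvature_pos : 0 < κ
  noise_pos : 0 < ζ
  curvatureBounded : CurvatureBounded S.curve κ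
  separated : Separated S.curve κ δ
  injective : Function.Injective S.point
  sampled : S.EpsSampled ε
  farther : S.AdjacentFartherThan ((1 + (2 : ℝ) ^ (3 / 2 : ℝ)) * (2 * ξ * ε + ζ))
  noisy : S.IsNoisyData ζ ξ p m
  lt_separation : 4 * ζ + 4 * ε * ξ + 2.1 * κ * ε ^ 2 < δ
  sampling_lt : ε < 1 / (κ * Real.sqrt 2)

namespace Admissible

variable {M N : ℕ} {S : SampledFigure M N} {p m : Fin N → Plane} {κ δ ε ζ ξ : ℝ}
  (A : Admissible S p m κ δ ε ζ ξ)

include A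

lemma exists_angle_lt (i : Fin N) : ∃ σ : ℝ, |σ| = 1 ∧ angle (m i) (σ • S.tangent i) < ξ := by
  obtain ⟨-, hm, h | h⟩ := A.noisy i
  · refine ⟨1, abs_one, ?_⟩
    rwa [one_smul, ← arccos_inner_eq_angle hm (S.norm_tangent i)]
  · refine ⟨-1, by simp, ?_⟩
    rwa [neg_one_smul, ← arccos_inner_eq_angle hm
      (by rw [norm_neg]; exact S.norm_tangent i)]

/-- The signs of `ξ`, `ε` and `δ` are not assumed; they follow once there is a sample. -/
lemma angleNoise_pos (i : Fin N) : 0 < ξ := by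
  obtain ⟨σ, -, h⟩ := A.exists_angle_lt i
  exact (angle_nonneg _ _).trans_lt h

lemma sampling_pos (i : Fin N) : 0 < ε := by
  obtain ⟨j, s, h⟩ := SampledFigure.exists_leads A.curvatureBounded (σ := 1) (by simp) i
  exact h.1.trans (A.sampled i j s (SampledFigure.leads_one_iff.1 h))

lemma separation_pos (i : Fin N) : 0 < δ := by
  have h1 := A.angleNoise_pos i
  have h2 := A.sampling_pos i
  have h3 := A.curvature_pos
  have h4 := A.noise_pos
  have := A.lt_separation
  have : 0 < 4 * ζ + 4 * ε * ξ + 2.1 * κ * ε ^ 2 := by positivity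
  linarith

lemma mul_sampling_lt : κ * ε < 0.7072 := by
  have h := A.sampling_lt
  have hκ := A.curvature_pos
  have h2 : (1.41421 : ℝ) ≤ Real.sqrt 2 := Real.le_sqrt_of_sq_le (by norm_num)
  rw [lt_div_iff₀ (by positivity)] at h
  by_contra! hge
  have : 0.7072 * 1.41421 ≤ κ * ε * Real.sqrt 2 :=
    mul_le_mul hge h2 (by norm_num) (by linarith)
  linarith

/-- The parameter of `j` is determined only up to periods, which the curve ignores; so branches from
`j` are shifted branches from `i`. -/
lemma branch_eq {i j : Fin N} {σ r : ℝ} (hl : S.label j = S.label i)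
    (hb : S.branch σ i r = S.point j) (τ u : ℝ) :
    S.branch τ j u = (S.curve (S.label i)).toFun (S.param i + σ * r + τ * u) := by
  have hb' : (S.curve (S.label i)).toFun (S.param i + σ * r)
      = (S.curve (S.label i)).toFun (S.param j) := by
    rw [SampledFigure.branch, SampledFigure.point, hl] at hb; exact hb
  obtain ⟨n, hn⟩ := A.separated.eq_add_int_mul_length A.curvature_pos (A.separation_pos i)
    A.curvatureBounded hb'
  have e : S.param j + τ * u
      = S.param i + σ * r + τ * u + n * (S.curve (S.label i)).length := by rw [hn]; ring
  rw [SampledFigure.branch, hl, e]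
  exact (S.curve (S.label i)).periodic.int_mul n _

lemma branch_add {i j : Fin N} {σ r : ℝ} (hl : S.label j = S.label i)
    (hb : S.branch σ i r = S.point j) (u : ℝ) : S.branch σ j u = S.branch σ i (r + u) := by
  rw [A.branch_eq hl hb, SampledFigure.branch, mul_add, add_assoc]

lemma branch_neg {i j : Fin N} {σ r : ℝ} (hl : S.label j = S.label i)
    (hb : S.branch σ i r = S.point j) (u : ℝ) : S.branch (-σ) j u = S.branch σ i (r - u) := by
  rw [A.branch_eq hl hb, SampledFigure.branch]; congr 1; ring

lemma leads_symm {σ : ℝ} {i j : Fin N} {s : ℝ} (h : S.Leads σ i j s) : S.Leads (-σ) j i s := by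
  obtain ⟨h0, hl, hb, hfree⟩ := h
  refine ⟨h0, hl.symm, ?_, fun u hu l hlj => ?_⟩
  · rw [A.branch_neg hl hb, sub_self, SampledFigure.branch_zero]
  · rw [A.branch_neg hl hb]
    exact hfree (s - u) ⟨by linarith [hu.2], by linarith [hu.1]⟩ l (hlj.trans hl)

lemma isNext_of_leads {σ : ℝ} (hσ : |σ| = 1) {i j : Fin N} {s : ℝ} (h : S.Leads σ i j s) :
    S.IsNext i j s ∨ S.IsNext j i s := by
  rcases eq_or_eq_neg_of_abs_eq hσ with rfl | rfl
  · exact Or.inl (SampledFigure.leads_one_iff.1 h)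
  · have := A.leads_symm h
    rw [neg_neg] at this
    exact Or.inr (SampledFigure.leads_one_iff.1 this)

lemma leads_lt {σ : ℝ} (hσ : |σ| = 1) {i j : Fin N} {s : ℝ} (h : S.Leads σ i j s) : s < ε := by
  rcases A.isNext_of_leads hσ h with h | h
  · exact A.sampled _ _ _ h
  · exact A.sampled _ _ _ h

lemma lt_dist_of_leads {σ : ℝ} (hσ : |σ| = 1) {i j : Fin N} {s : ℝ} (h : S.Leads σ i j s) :
    3.828 * (2 * ξ * ε + ζ) < dist (S.point j) (S.point i) := by
  have h1 : (2.828 : ℝ) ≤ (2 : ℝ) ^ (3 / 2 : ℝ) := by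
    have h0 : ((2 : ℝ) ^ (3 / 2 : ℝ)) ^ 2 = 8 := by
      rw [← Real.rpow_natCast, ← Real.rpow_mul (by norm_num)]; norm_num
    exact le_of_sq_le_sq (by rw [h0]; norm_num) (by positivity)
  have h2 : 0 < 2 * ξ * ε + ζ := by
    have := A.angleNoise_pos i; have := A.sampling_pos i; have := A.noise_pos; positivity
  have h3 : (1 + (2 : ℝ) ^ (3 / 2 : ℝ)) * (2 * ξ * ε + ζ) < dist (S.point j) (S.point i) := by
    rcases A.isNext_of_leads hσ h with h | h
    · rw [dist_comm]; exact A.farther _ _ _ h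
    · exact A.farther _ _ _ h
  nlinarith

lemma lt_arc_of_leads {σ : ℝ} (hσ : |σ| = 1) {i j : Fin N} {s : ℝ} (h : S.Leads σ i j s) :
    3.828 * (2 * ξ * ε + ζ) < s := by
  refine (A.lt_dist_of_leads hσ h).trans_le ?_
  have := (SampledFigure.unitSpeedPath_branch A.curvatureBounded hσ i).norm_sub_le s 0
  rwa [SampledFigure.branch_zero, h.2.2.1, ← dist_eq_norm, sub_zero, abs_of_pos h.1] at this

/-- A lone sample would be adjacent to itself at distance zero, so the spacing assumption puts at
least two samples on every sampled curve. -/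
lemma ne_of_leads {σ : ℝ} (hσ : |σ| = 1) {i j : Fin N} {s : ℝ} (h : S.Leads σ i j s) :
    j ≠ i := by
  rintro rfl
  have h1 := A.lt_dist_of_leads hσ h
  rw [dist_self] at h1
  have : 0 < 2 * ξ * ε + ζ := by
    have := A.angleNoise_pos j; have := A.sampling_pos j; have := A.noise_pos; positivity
  linarith

/-- A sample met after a short arc lies in the noisy allowed region. -/
lemma nonempty_of_branch {σ : ℝ} (hσ : |σ| = 1) {i j : Fin N} {s : ℝ} (hs0 : 0 < s) (hs : s < ε)
    (hb : S.branch σ i s = S.point j) (hne : j ≠ i) :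
    (Metric.ball (p j) ζ ∩ noisyAllowedRegion κ ε ζ ξ (p i) (m i)).Nonempty := by
  have hκ := A.curvature_pos
  obtain ⟨τ, hτ, hang⟩ := A.exists_angle_lt i
  have hpath := SampledFigure.unitSpeedPath_branch A.curvatureBounded hσ i
  have hκs : κ * s ≤ Real.pi / 2 := by
    have := A.mul_sampling_lt
    have := mul_lt_mul_of_pos_left hs hκ
    linarith [Real.pi_gt_three]
  have hperp := hpath.two_mul_abs_inner_perp_le hκ hs0.le hκs
  have hdist : ‖S.branch σ i s - S.branch σ i 0‖ < ε :=
    (hpath.norm_sub_le s 0).trans_lt (by rwa [sub_zero, abs_of_pos hs0])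
  rw [hb, SampledFigure.branch_zero] at hdist hperp
  refine nonempty_ball_inter_noisyAllowedRegion hκ A.noise_pos (T := τ • S.tangent i)
    (by rw [norm_smul, S.norm_tangent, mul_one]; exact hτ) (A.noisy i).2.1 hang
    (fun h => hne (A.injective h)) hdist ?_ (A.noisy i).1 (A.noisy j).1
  have e : ∀ {ρ : ℝ}, |ρ| = 1 → |inner ℝ (S.point j - S.point i) (perp (ρ • S.tangent i))|
      = |inner ℝ (S.point j - S.point i) (perp (S.tangent i))| := by
    intro ρ hρ
    rw [perp_smul, inner_smul_right, abs_mul, hρ, one_mul]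
  rw [mul_zero, add_zero] at hperp
  rw [e hτ]
  exact (e hσ) ▸ hperp

lemma candidateEdge_of_leads {σ : ℝ} (hσ : |σ| = 1) {i j : Fin N} {s : ℝ}
    (h : S.Leads σ i j s) : CandidateEdge κ ε ζ ξ p m i j := by
  have hs := A.leads_lt hσ h
  have h' := A.leads_symm h
  have hne := A.ne_of_leads hσ h
  exact ⟨A.nonempty_of_branch (by rwa [abs_neg]) h.1 hs h'.2.2.1 hne.symm,
    A.nonempty_of_branch hσ h.1 hs h.2.2.1 hne⟩

/-- A candidate lies on the same curve, at a short arc distance. -/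
lemma exists_branch_of_candidateEdge {i j : Fin N} (h : CandidateEdge κ ε ζ ξ p m i j) :
    S.label j = S.label i ∧ dist (S.point j) (S.point i) < ε + 4 * ζ ∧
      ∃ r, κ * |r| ≤ Real.pi / 2 + κ * ε ∧ S.branch 1 i r = S.point j := by
  have hκ := A.curvature_pos
  have hε := A.sampling_pos i
  have hξ := A.angleNoise_pos i
  obtain ⟨τ, hτ, hang⟩ := A.exists_angle_lt i
  have hpath := SampledFigure.unitSpeedPath_branch A.curvatureBounded hτ i
  obtain ⟨hC, a, ha, had⟩ := hpath.exists_dist_lt hκ (A.noisy i).2.1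
    (by rw [mul_zero, add_zero]; exact hang)
    (by rw [SampledFigure.branch_zero]; exact (A.noisy i).1) (A.noisy j).1 h.2
  rw [SampledFigure.branch_zero, ← dist_eq_norm] at hC
  have hlt : dist (S.branch τ i a) (S.point j) < δ := by
    have := A.lt_separation
    have h1 : 0 < ε * ξ := mul_pos hε hξ
    have h2 : 0 < κ * ε ^ 2 := by positivity
    nlinarith
  have hl : S.label j = S.label i := by
    by_contra hne
    exact (A.separated.1 _ _ (Ne.symm hne) _ _).not_gt hlt
  refine ⟨hl, hC, ?_⟩
  have hpt : S.point j = (S.curve (S.label i)).toFun (S.param j) := by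
    rw [SampledFigure.point, hl]
  rw [hpt, SampledFigure.branch] at hlt
  obtain ⟨n, hn⟩ := A.separated.exists_abs_le hlt
  set ℓ := (S.curve (S.label i)).length with hℓ
  set b := S.param i + τ * a - S.param j + n * ℓ with hb
  -- Go from `i` by `τ * a` to the nearby curve point, then by `-b` to `j`; `b` is a representative
  -- of the arc difference of size at most `π / (2κ)`.
  refine ⟨τ * a - b, ?_, ?_⟩
  · have h1 : |τ * a - b| ≤ ε + κ⁻¹ * Real.pi / 2 := by
      refine (abs_sub _ _).trans ?_
      rw [abs_mul, hτ, one_mul]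
      linarith
    have h2 := mul_le_mul_of_nonneg_left h1 hκ.le
    rw [mul_add, ← mul_div_assoc, mul_inv_cancel_left₀ hκ.ne'] at h2
    linarith
  · have e : S.param i + 1 * (τ * a - b) = S.param j - n * ℓ := by rw [hb]; ring
    rw [hpt, SampledFigure.branch, e]
    exact (S.curve (S.label i)).periodic.sub_int_mul_eq n

end Admissible

/-! ### The nearest candidate on each side. -/

lemma IsNearestSelection.eq_some {N : ℕ} {p m : Fin N → Plane} {κ ε ζ ξ τ : ℝ}
    {i k : Fin N}
    {r : Fin N → Option (Fin N)}
    (hr : IsNearestSelection κ ε ζ ξ p m τ r) (hk : k ∈ sideCandidates κ ε ζ ξ p m τ i)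
    (hmin : ∀ j ∈ sideCandidates κ ε ζ ξ p m τ i, j ≠ k →
      |inner ℝ (p k - p i) (m i)| < |inner ℝ (p j - p i) (m i)|) : r i = some k := by
  obtain ⟨h1, h2⟩ := hr i
  rcases h : r i with _ | j
  · rw [h1 h] at hk; exact hk.elim
  · obtain ⟨hj, hjmin⟩ := h2 j h
    by_contra hne
    exact (hmin j hj fun e => hne (by rw [e])).not_ge (hjmin k hk)

namespace Admissible

variable {M N : ℕ} {S : SampledFigure M N} {p m : Fin N → Plane} {κ δ ε ζ ξ : ℝ}
  (A : Admissible S p m κ δ ε ζ ξ)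

include A

lemma le_dist_of_far {i j : Fin N} {σ r : ℝ} (hσ : |σ| = 1)
    (hb : S.branch σ i r = S.point j) (hr : Real.pi / 2 < κ * r)
    (hr' : κ * r < 3 * Real.pi / 2) : δ ≤ dist (S.point j) (S.point i) := by
  rw [← hb, dist_comm]
  exact A.separated.le_dist_of_arc A.curvature_pos A.curvatureBounded hσ hr hr'

/-- Continue along the branch from `j` to arc `π / (2κ)`, where separation takes effect; the
triangle inequality costs the remaining arc. -/
lemma mul_le_dist_add {i j : Fin N} {σ r : ℝ} (hσ : |σ| = 1)
    (hb : S.branch σ i r = S.point j) (hr : κ * r ≤ Real.pi / 2) :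
    κ * δ ≤ κ * dist (S.point j) (S.point i) + (Real.pi / 2 - κ * r) := by
  have hκ := A.curvature_pos
  have hpi := Real.pi_gt_three
  refine le_of_forall_pos_le_add fun η hη => ?_
  -- Separation needs an arc strictly beyond `π / (2κ)`, hence an overshoot `θ`; the cap `1` keeps
  -- it below `3π / (2κ)`.
  set θ := min η 1 with hθ
  have hθ0 : 0 < θ := lt_min hη one_pos
  have hθ1 : θ ≤ 1 := min_le_right _ _
  set t := κ⁻¹ * (Real.pi / 2 + θ) with ht
  have hκt : κ * t = Real.pi / 2 + θ := by rw [ht, mul_inv_cancel_left₀ hκ.ne']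
  have h1 : δ ≤ dist (S.point i) (S.branch σ i t) :=
    A.separated.le_dist_of_arc hκ A.curvatureBounded hσ (by linarith) (by linarith)
  have h2 := (SampledFigure.unitSpeedPath_branch A.curvatureBounded hσ i).norm_sub_le r t
  rw [hb, ← dist_eq_norm, abs_sub_comm] at h2
  have h3 : κ * |t - r| = Real.pi / 2 + θ - κ * r := by
    rw [← abs_of_pos hκ, ← abs_mul, abs_of_pos hκ, mul_sub, hκt]
    exact abs_of_nonneg (by linarith)
  have h4 := dist_triangle (S.point i) (S.point j) (S.branch σ i t)
  rw [dist_comm (S.point i) (S.point j)] at h4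
  have h5 : κ * δ ≤ κ * (dist (S.point j) (S.point i) + |t - r|) :=
    mul_le_mul_of_nonneg_left (by linarith) hκ.le
  have h6 : θ ≤ η := min_le_left _ _
  rw [mul_add] at h5
  linarith

lemma scaled_lt {s : ℝ} (h : 3.828 * (2 * ξ * ε + ζ) < s) :
    3.828 * (2 * ξ * (κ * ε) + κ * ζ) < κ * s := by
  have := mul_lt_mul_of_pos_left h A.curvature_pos
  linarith

lemma scaled_separation :
    4 * (κ * ζ) + 4 * (κ * ε) * ξ + 2.1 * (κ * ε) ^ 2 < κ * δ := by
  have := mul_lt_mul_of_pos_left A.lt_separation A.curvature_pos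
  linarith

lemma sub_two_mul_le_inner {w : Plane} (hw : ‖w‖ = 1) (i j : Fin N) :
    inner ℝ (S.point j - S.point i) w - 2 * ζ ≤ inner ℝ (p j - p i) w := by
  have h1 : inner ℝ (S.point j - S.point i) w
      = inner ℝ (p j - p i) w + inner ℝ ((S.point j - p j) + (p i - S.point i)) w := by
    rw [← inner_add_left]; congr 1; abel
  have h2 := real_inner_le_norm ((S.point j - p j) + (p i - S.point i)) w
  have h3 := norm_add_le (S.point j - p j) (p i - S.point i)
  have h4 := (A.noisy j).1
  have h5 := (A.noisy i).1
  rw [dist_comm, dist_eq_norm] at h4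
  rw [dist_eq_norm] at h5
  rw [hw, mul_one] at h2
  linarith

section Advance

variable {σ : ℝ} {i j k : Fin N} {s r : ℝ} {w : Plane}

/-- Up to `κ * r + ξ = π / 2` the sine increases, so the bound for the first sample at arc `s` also
serves at arc `r`. -/
lemma inner_pos_of_leads (hσ : |σ| = 1) (hk : S.Leads σ i k s) (hw : ‖w‖ = 1)
    (hang : angle w (σ • S.tangent i) < ξ) (hr : s ≤ r) (hr' : κ * r ≤ Real.pi / 2 - ξ)
    (hb : S.branch σ i r = S.point j) : 0 < inner ℝ (p j - p i) w := by
  have hκ := A.curvature_pos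
  have hξ := A.angleNoise_pos i
  have hs := mul_pos hκ hk.1
  have hsr : κ * s ≤ κ * r := mul_le_mul_of_nonneg_left hr hκ.le
  have h := (SampledFigure.unitSpeedPath_branch A.curvatureBounded hσ i).sin_sub_sin_le_inner hκ
    hw (ξ := ξ) (by rw [mul_zero, add_zero, angle_comm]; exact hang.le) le_rfl (hk.1.le.trans hr)
    (by linarith [Real.pi_pos])
  rw [hb, SampledFigure.branch_zero, mul_zero, zero_add] at h
  have h1 := two_mul_lt_sin_sub_sin hξ A.mul_sampling_lt
    (mul_lt_mul_of_pos_left (A.leads_lt hσ hk) hκ) (A.scaled_lt (A.lt_arc_of_leads hσ hk))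
    (mul_pos hκ A.noise_pos) (mul_pos hκ (A.sampling_pos i))
  have h2 : Real.sin (κ * s + ξ) ≤ Real.sin (κ * r + ξ) :=
    Real.sin_le_sin_of_le_of_le_pi_div_two (by linarith [Real.pi_pos]) (by linarith) (by linarith)
  have h3 := A.sub_two_mul_le_inner hw i j
  have h4 : κ * (2 * ζ) < κ * inner ℝ (S.point j - S.point i) w := by linarith
  linarith [lt_of_mul_lt_mul_left h4 hκ.le]

lemma mul_arc_le (hσ : |σ| = 1) (hk : S.Leads σ i k s) (hr0 : 0 < r)
    (hr : κ * r ≤ Real.pi / 2 + κ * ε) (hb : S.branch σ i r = S.point j)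
    (hC : dist (S.point j) (S.point i) < ε + 4 * ζ) : κ * r ≤ Real.pi / 2 - ξ := by
  have hκ := A.curvature_pos
  have he := A.mul_sampling_lt
  have hpi := Real.pi_gt_three
  have hC' := mul_lt_mul_of_pos_left hC hκ
  have hpath := SampledFigure.unitSpeedPath_branch A.curvatureBounded hσ i
  have hchord := hpath.two_mul_sin_le_norm_sub hκ hr0.le (by linarith)
  rw [hb, SampledFigure.branch_zero, ← dist_eq_norm] at hchord
  exact arc_le_pi_div_two_sub (A.angleNoise_pos i) he
    (mul_lt_mul_of_pos_left (A.leads_lt hσ hk) hκ) (A.scaled_lt (A.lt_arc_of_leads hσ hk))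
    (mul_pos hκ A.noise_pos) (mul_pos hκ (A.sampling_pos i)) hr (by linarith) hchord
    A.scaled_separation
    (fun h => mul_le_mul_of_nonneg_left (A.le_dist_of_far hσ hb h (by linarith)) hκ.le)
    (fun h => A.mul_le_dist_add hσ hb h)

/-- The sample `l` after `k` supplies the gap: `j` is not met before `l`, and the advance from `k`
to `l` already beats the noise. -/
lemma inner_lt_of_leads (hσ : |σ| = 1) (hk : S.Leads σ i k s) (hw : ‖w‖ = 1)
    (hang : angle w (σ • S.tangent i) < ξ) (hr : s ≤ r) (hr' : κ * r ≤ Real.pi / 2 - ξ)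
    (hl : S.label j = S.label i) (hb : S.branch σ i r = S.point j)
    (hC : dist (S.point j) (S.point i) < ε + 4 * ζ) (hjk : j ≠ k) :
    inner ℝ (p k - p i) w < inner ℝ (p j - p i) w := by
  have hκ := A.curvature_pos
  have hξ := A.angleNoise_pos i
  have hlt : s < r := lt_of_le_of_ne hr fun h =>
    hjk (A.injective (by rw [← hb, ← hk.2.2.1, h]))
  obtain ⟨l, h, hkl⟩ := SampledFigure.exists_leads A.curvatureBounded hσ k
  have hsh : s + h ≤ r := by
    have hb' : S.branch σ k (r - s) = S.point j := by
      rw [A.branch_add hk.2.1 hk.2.2.1, add_sub_cancel, hb]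
    linarith [hkl.le (sub_pos.2 hlt) (hl.trans hk.2.1.symm) hb']
  have hs0 := mul_pos hκ hk.1
  have hh0 := mul_pos hκ hkl.1
  have hshr : κ * s + κ * h ≤ κ * r := by
    rw [← mul_add]; exact mul_le_mul_of_nonneg_left hsh hκ.le
  have h1 := (SampledFigure.unitSpeedPath_branch A.curvatureBounded hσ i).sin_sub_sin_le_inner hκ
    hw (ξ := ξ) (by rw [mul_zero, add_zero, angle_comm]; exact hang.le) hk.1.le hr
    (by linarith [Real.pi_pos])
  rw [hb, hk.2.2.1] at h1
  have h2 := two_mul_lt_sin_sub_sin_of_next hξ A.mul_sampling_lt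
    (mul_lt_mul_of_pos_left (A.leads_lt hσ hk) hκ)
    (mul_lt_mul_of_pos_left (A.leads_lt hσ hkl) hκ)
    (A.scaled_lt (A.lt_arc_of_leads hσ hk)) (A.scaled_lt (A.lt_arc_of_leads hσ hkl))
    (mul_pos hκ A.noise_pos) (mul_pos hκ (A.sampling_pos i)) hshr
    (by have := mul_lt_mul_of_pos_left hC hκ; linarith) A.scaled_separation
    (A.mul_le_dist_add hσ hb (by linarith))
  have h3 : Real.sin (κ * s + κ * h + ξ) ≤ Real.sin (κ * r + ξ) :=
    Real.sin_le_sin_of_le_of_le_pi_div_two (by linarith [Real.pi_pos]) (by linarith) (by linarith)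
  have h4 := A.sub_two_mul_le_inner hw k j
  have h5 : κ * (2 * ζ) < κ * inner ℝ (S.point j - S.point k) w := by linarith
  have h6 := lt_of_mul_lt_mul_left h5 hκ.le
  have h7 : inner ℝ (p j - p k) w = inner ℝ (p j - p i) w - inner ℝ (p k - p i) w := by
    rw [← inner_sub_left]; congr 1; abel
  linarith

end Advance

/-- On each side of a sample, the neighbour on the curve is the strictly nearest candidate. -/
lemma exists_nearest (i : Fin N) {τ : ℝ} (hτ : |τ| = 1) {σ : ℝ} (hσ : |σ| = 1)
    (hang : angle (m i) (σ • S.tangent i) < ξ) :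
    ∃ k s, S.Leads (τ * σ) i k s ∧ k ∈ sideCandidates κ ε ζ ξ p m τ i ∧
      ∀ j ∈ sideCandidates κ ε ζ ξ p m τ i, j ≠ k →
        |inner ℝ (p k - p i) (m i)| < |inner ℝ (p j - p i) (m i)| := by
  have hκ := A.curvature_pos
  have hρ : |τ * σ| = 1 := by rw [abs_mul, hτ, hσ, one_mul]
  have hw : ‖τ • m i‖ = 1 := by rw [norm_smul, (A.noisy i).2.1, mul_one]; exact hτ
  have hτ0 : τ ≠ 0 := by rw [← abs_pos, hτ]; exact one_pos
  have hang' : angle (τ • m i) ((τ * σ) • S.tangent i) < ξ := by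
    rw [mul_smul, angle_smul_smul hτ0]; exact hang
  have habs : ∀ x : ℝ, 0 < τ * x → |x| = τ * x := fun x hx => by
    rw [← abs_of_pos hx, abs_mul, hτ, one_mul]
  obtain ⟨k, s, hk⟩ := SampledFigure.exists_leads A.curvatureBounded hρ i
  have hcand := A.candidateEdge_of_leads hρ hk
  have hmem : k ∈ sideCandidates κ ε ζ ξ p m τ i := by
    refine ⟨hcand, ?_⟩
    rw [← inner_smul_right]
    have hs := A.leads_lt hρ hk
    refine A.inner_pos_of_leads hρ hk hw hang' le_rfl ?_ hk.2.2.1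
    refine A.mul_arc_le hρ hk hk.1 ?_ hk.2.2.1 (A.exists_branch_of_candidateEdge hcand).2.1
    have := mul_lt_mul_of_pos_left hs hκ
    linarith [Real.pi_pos]
  refine ⟨k, s, hk, hmem, fun j hj hjk => ?_⟩
  rw [habs _ hmem.2, habs _ hj.2, ← inner_smul_right, ← inner_smul_right]
  have hjpos := hj.2
  rw [← inner_smul_right] at hjpos
  obtain ⟨hl, hC, r, hr, hb⟩ := A.exists_branch_of_candidateEdge hj.1
  have hr0 : r ≠ 0 := by
    rintro rfl
    rw [SampledFigure.branch_zero] at hb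
    have := A.injective hb
    subst this
    simp at hjpos
  obtain ⟨ρ, hρ', hρr⟩ := exists_sign_mul_abs_eq r
  have hb' : S.branch ρ i |r| = S.point j := by
    rw [← hb, SampledFigure.branch, hρr, SampledFigure.branch, one_mul]
  have hrpos := abs_pos.2 hr0
  obtain ⟨k', s', hk'⟩ := SampledFigure.exists_leads A.curvatureBounded hρ' i
  have hle := A.mul_arc_le hρ' hk' hrpos hr hb' hC
  rcases abs_eq_abs.1 (hρ'.trans hρ.symm) with h | h
  · rw [h] at hb'
    exact A.inner_lt_of_leads hρ hk hw hang' (hk.le hrpos hl hb') hle hl hb' hC hjk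
  -- On the opposite branch `j` lies ahead in the direction `-(τ • m i)`, so it is not on the side
  -- `τ`.
  · have := A.inner_pos_of_leads hρ' hk' (w := -(τ • m i)) (by rw [norm_neg, hw])
      (by rw [h, neg_smul, angle_neg_neg]; exact hang') (hk'.le hrpos hl hb') hle hb'
    rw [inner_neg_right] at this
    linarith

/-- Any two nearest selections produce the polygonalization. -/
lemma fromRel_eq_polygonalization {rPlus rMinus : Fin N → Option (Fin N)}
    (hp : IsNearestSelection κ ε ζ ξ p m 1 rPlus)
    (hm : IsNearestSelection κ ε ζ ξ p m (-1) rMinus) :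
    SimpleGraph.fromRel (fun i j => rPlus i = some j ∨ rMinus i = some j)
      = S.polygonalization := by
  have key : ∀ i j, (rPlus i = some j ∨ rMinus i = some j) ↔
      ∃ s, S.Leads 1 i j s ∨ S.Leads (-1) i j s := by
    intro i j
    obtain ⟨σ, hσ, hang⟩ := A.exists_angle_lt i
    obtain ⟨k, s, hk, hkm, hkn⟩ := A.exists_nearest i (τ := 1) (by simp) hσ hang
    obtain ⟨l, t, hl, hlm, hln⟩ := A.exists_nearest i (τ := -1) (by simp) hσ hang
    rw [hp.eq_some hkm hkn, hm.eq_some hlm hln, Option.some_inj, Option.some_inj]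
    have huniq : ∀ {ρ : ℝ} {a b : Fin N} {u : ℝ}, S.Leads ρ i a u →
        ((∃ v, S.Leads ρ i b v) ↔ a = b) := fun ha =>
      ⟨fun ⟨_, hb⟩ => ha.unique A.injective hb, fun h => ⟨_, h ▸ ha⟩⟩
    rw [exists_or]
    -- The unknown orientation of `m i` only exchanges the two neighbours.
    rcases eq_or_eq_neg_of_abs_eq hσ with rfl | rfl
    · rw [one_mul] at hk; rw [mul_one] at hl
      rw [huniq hk, huniq hl]
    · rw [one_mul] at hk; rw [neg_mul_neg, one_mul] at hl
      rw [huniq hk, huniq hl, or_comm]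
  have hsymm : ∀ i j, (∃ s, S.Leads (-1) i j s) ↔ ∃ s, S.Leads 1 j i s := fun i j =>
    ⟨fun ⟨s, h⟩ => ⟨s, by simpa using A.leads_symm h⟩, fun ⟨s, h⟩ => ⟨s, A.leads_symm h⟩⟩
  ext i j
  simp only [SampledFigure.polygonalization, SimpleGraph.fromRel_adj, key, exists_or, hsymm,
    ← SampledFigure.leads_one_iff]
  tauto

/-- Needed for the converse: an output exists. Both sides of every sample are nonempty, so `none`
never occurs. -/
lemma exists_isNearestSelection {τ : ℝ} (hτ : |τ| = 1) :
    ∃ r, IsNearestSelection κ ε ζ ξ p m τ r := by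
  choose σ hσ hang using A.exists_angle_lt
  choose k s _ hmem hmin using fun i => A.exists_nearest i hτ (hσ i) (hang i)
  refine ⟨fun i => some (k i), fun i => ⟨fun h => (Option.some_ne_none _ h).elim, fun j hj => ?_⟩⟩
  obtain rfl := Option.some_inj.1 hj
  refine ⟨hmem i, fun l hl => ?_⟩
  rcases eq_or_ne l (k i) with rfl | hne
  · exact le_rfl
  · exact (hmin i l hl hne).le

end Admissible

end CurveReconstruction

theorem mainTheorem2 {M N : ℕ} (S : CurveReconstruction.SampledFigure M N)
    (p m : Fin N → CurveReconstruction.Plane) (κ δ ε ζ ξ : ℝ)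
    (hκ : 0 < κ) (hζ : 0 < ζ)
    (hcurv : CurveReconstruction.CurvatureBounded S.curve κ)
    (hsep : CurveReconstruction.Separated S.curve κ δ)
    (hdistinct : Function.Injective S.point)
    (hsampled : S.EpsSampled ε)
    (hadj : S.AdjacentFartherThan ((1 + (2 : ℝ) ^ (3 / 2 : ℝ)) * (2 * ξ * ε + ζ)))
    (hnoise : S.IsNoisyData ζ ξ p m)
    (hδ : 4 * ζ + 4 * ε * ξ + 2.1 * κ * ε ^ 2 < δ)
    (hε : ε < 1 / (κ * Real.sqrt 2)) :
    ∀ Γ : SimpleGraph (Fin N),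
      CurveReconstruction.IsNoisyPolygonalizationOutput κ ε ζ ξ p m Γ ↔
        Γ = S.polygonalization := by
  have A : CurveReconstruction.Admissible S p m κ δ ε ζ ξ :=
    ⟨hκ, hζ, hcurv, hsep, hdistinct, hsampled, hadj, hnoise, hδ, hε⟩
  intro Γ
  constructor
  · rintro ⟨rPlus, rMinus, hp, hm, rfl⟩
    exact A.fromRel_eq_polygonalization hp hm
  · rintro rfl
    obtain ⟨rPlus, hp⟩ := A.exists_isNearestSelection (τ := 1) (by simp)
    obtain ⟨rMinus, hm⟩ := A.exists_isNearestSelection (τ := -1) (by simp)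
    exact ⟨rPlus, rMinus, hp, hm, (A.fromRel_eq_polygonalization hp hm).symm⟩
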